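/- Let $V$ be a finite-dimensional real Euclidean space with inner product $\langle\cdot,\cdot\rangle$ and norm $\|\cdot\|$, and let $R\subset V$ be a finite, reduced, irreducible crystallographic root system spanning $V$, with coroots $\alpha^\vee=2\alpha/\|\alpha\|^2$ $(\alpha\in R)$ and a fixed positive system $R^+$ (given by a basis of simple roots). Let $W$ be the Weyl group, $Q^\vee$ the lattice generated by the coroots, $W^a=W\ltimes Q^\vee$ the affine Weyl group acting on $V$ ($Q^\vee$ acting by translations), $A=\{v\in V \mid 0<\langle\alpha,v\rangle<1\ \forall\alpha\in R^+\}$ the Weyl alcove, $L^2(A)$ the Hilbert space of square-integrable complex-valued functions on $A$ with respect to Euclidean measure, and $\mathcal P^+=\{\lambda\in V\mid \langle\lambda,\alpha^\vee\rangle\in\mathbb Z_{\ge0}\ \forall\alpha\in R^+\}$. Let $D_0\subset L^2(A)$ be the space of restrictions to $A$ of the $W^a$-invariant functions in $C^\infty(V)$ (complex-valued), and let $-\Delta$ be the negative Laplacian with domain $D_0$, that is $F|_A\mapsto -(\Delta F)|_A$. For $\mu\in V$ put $$\phi^0_\mu(v)=\frac1{\#W}\sum_{w\in W}e^{i\langle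 w\mu,v\rangle}.$$ Then: 1. The operator $(-\Delta,D_0)$ on $L^2(A)$ is essentially self-adjoint (densely defined and symmetric, with self-adjoint closure) and positive, i.e. $(f,-\Delta f)\ge 0$ for all $f\in D_0$. It has a unique self-adjoint extension $(H_0,D(H_0))$; this extension is positive, and $D_0$ is an operator core for it, i.e. $H_0$ is the closure of its restriction to $D_0$. 2. For every $\mu\in2\pi\mathcal P^+$ the function $\phi^0_\mu$ belongs to $D_0\subset D(H_0)$, is nonzero, and satisfies $H_0\phi^0_\mu=\|\mu\|^2\phi^0_\mu$. The functions $\phi^0_\mu$, $\mu\in2\pi\mathcal P^+$, are pairwise orthogonal in $L^2(A)$, and their linear span is dense in $L^2(A)$. 3. $H_0$ has compact resolvent: its resolvent set is nonempty, and $(H_0-z)^{-1}$ is a compact operator for every $z$ in the resolvent set. -/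

import Mathlib

open MeasureTheory
open scoped ContDiff InnerProductSpace Laplacian

noncomputable section

/-! ### Unbounded operators on a complex Hilbert space -/

namespace UnboundedOperator

variable {H : Type*} [NormedAddCommGroup H] [InnerProductSpace ℂ H]

/-- Positivity (nonnegativity) of an operator: `0 ≤ ⟪f, T f⟫` for all `f` in the domain. It is used
only for symmetric operators, for which `⟪f, T f⟫` is real. -/
def IsPositive (T : H →ₗ.[ℂ] H) : Prop :=
  ∀ f : T.domain, 0 ≤ (⟪(f : H), T f⟫_ℂ).re

/-- A densely defined symmetric operator whose closure is self-adjoint. -/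
structure IsEssentiallySelfAdjoint [CompleteSpace H] (T : H →ₗ.[ℂ] H) : Prop where
  dense_domain : Dense (T.domain : Set H)
  symmetric : T.IsFormalAdjoint T
  isSelfAdjoint_closure : IsSelfAdjoint T.closure

/-- `R` is the (bounded, everywhere defined) resolvent `(T - z)⁻¹` of `T` at `z`. -/
def IsResolventAt (T : H →ₗ.[ℂ] H) (z : ℂ) (R : H →L[ℂ] H) : Prop :=
  (∀ g : H, ∃ h : R g ∈ T.domain, T ⟨R g, h⟩ - z • R g = g) ∧
    ∀ f : T.domain, R (T f - z • (f : H)) = f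

/-- The resolvent set of `T` is nonempty and all resolvents `(T - z)⁻¹` are compact. -/
def HasCompactResolvent (T : H →ₗ.[ℂ] H) : Prop :=
  (∃ z R, IsResolventAt T z R) ∧ ∀ z R, IsResolventAt T z R → IsCompactOperator R

end UnboundedOperator

/-! ### Smooth functions on a Euclidean space and the Laplacian -/

namespace WeylAlcove

section Smooth

variable (V : Type*) [NormedAddCommGroup V] [InnerProductSpace ℝ V]

/-- The space `C^∞(V)` of smooth complex-valued functions on `V`. -/
def smoothFunctions : Submodule ℂ (V → ℂ) where
  carrier := {F | ContDiff ℝ ∞ F}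
  add_mem' {F G} (hF : ContDiff ℝ ∞ F) (hG : ContDiff ℝ ∞ G) := hF.add hG
  zero_mem' := (contDiff_const : ContDiff ℝ ∞ fun _ : V ↦ (0 : ℂ))
  smul_mem' c F (hF : ContDiff ℝ ∞ F) := hF.const_smul c

variable [FiniteDimensional ℝ V]

/-- The Laplacian of a smooth function is smooth. -/
theorem contDiff_laplacian {F : V → ℂ} (hF : ContDiff ℝ ∞ F) : ContDiff ℝ ∞ (Δ F) := by
  rw [InnerProductSpace.laplacian_eq_iteratedFDeriv_stdOrthonormalBasis]
  refine ContDiff.sum fun i _ ↦ ?_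
  have h : ContDiff ℝ ∞ (iteratedFDeriv ℝ 2 F) := hF.iteratedFDeriv_right (m := ∞) (i := 2) (by
    exact le_refl _)
  exact (ContinuousMultilinearMap.apply ℝ (fun _ : Fin 2 ↦ V) ℂ
    ![stdOrthonormalBasis ℝ V i, stdOrthonormalBasis ℝ V i]).contDiff.comp h

theorem two_le_infty : (2 : WithTop ℕ∞) ≤ ∞ := by
  have h : ((2 : ℕ∞) : WithTop ℕ∞) ≤ ((⊤ : ℕ∞) : WithTop ℕ∞) := WithTop.coe_le_coe.mpr le_top
  exact h

/-- The Laplacian `Δ` as a linear operator on `C^∞(V)`. -/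
def laplacian : smoothFunctions V →ₗ[ℂ] smoothFunctions V where
  toFun F := ⟨Δ (F : V → ℂ), contDiff_laplacian V F.2⟩
  map_add' F G := by
    ext x
    have hF : ContDiff ℝ ∞ (F : V → ℂ) := F.2
    have hG : ContDiff ℝ ∞ (G : V → ℂ) := G.2
    exact (hF.of_le two_le_infty).contDiffAt.laplacian_add
      (hG.of_le two_le_infty).contDiffAt
  map_smul' c F := by
    ext x
    have hF : ContDiff ℝ ∞ (F : V → ℂ) := F.2
    exact InnerProductSpace.laplacian_smul c (hF.of_le two_le_infty).contDiffAt

end Smooth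

/-! ### Root systems in a Euclidean space, the alcove and the affine Weyl group -/

variable {ι V : Type*} [NormedAddCommGroup V] [InnerProductSpace ℝ V]

/-- A root system whose roots and coroots both lie in the Euclidean space `V`, paired by the inner
product of `V`, with the coroot of a root `α` equal to `2 α / ‖α‖²` (so that the reflections of
the root system are the orthogonal reflections in the hyperplanes perpendicular to the roots). -/
class IsEuclidean (P : RootPairing ι ℝ V V) : Prop where
  pairing_eq_inner : ∀ x y : V, P.toLinearMap x y = ⟪x, y⟫_ℝ
  coroot_eq : ∀ i, P.coroot i = (2 / ‖P.root i‖ ^ 2) • P.root i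

/-- The affine Weyl group `W ⋉ Q^∨`: the group of affine transformations of `V` generated by the
reflections of the root system (which generate `W`) and by the translations by the coroots (which
generate the coroot lattice `Q^∨`). -/
def affineWeylGroup (P : RootPairing ι ℝ V V) : Subgroup (V ≃ᵃ[ℝ] V) :=
  Subgroup.closure (Set.range (fun i ↦ (P.reflection i).toAffineEquiv) ∪
    Set.range (fun i ↦ AffineEquiv.constVAdd ℝ V (P.coroot i)))

/-- The smooth functions on `V` that are invariant under the affine Weyl group. -/
def invariantSmoothFunctions (P : RootPairing ι ℝ V V) : Submodule ℂ (smoothFunctions V) where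
  carrier := {F | ∀ w ∈ affineWeylGroup P, ∀ v : V, (F : V → ℂ) (w v) = (F : V → ℂ) v}
  add_mem' hF hG w hw v := by simp [hF w hw v, hG w hw v]
  zero_mem' w _ v := rfl
  smul_mem' c F hF w hw v := by simp [hF w hw v]

variable {P : RootPairing ι ℝ V V}

/-- The open Weyl alcove `{v | 0 < ⟨α, v⟩ < 1 for all positive roots α}`. -/
def alcove (b : P.Base) : Set V :=
  {v | ∀ i, b.IsPos i → 0 < ⟪P.root i, v⟫_ℝ ∧ ⟪P.root i, v⟫_ℝ < 1}

/-- The dominant weights `{μ | ⟨μ, α^∨⟩ ∈ ℤ_{≥ 0} for all positive roots α}`. -/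
def dominantWeights (b : P.Base) : Set V :=
  {μ | ∀ i, b.IsPos i → ∃ n : ℕ, ⟪μ, P.coroot i⟫_ℝ = n}

theorem isOpen_alcove [Finite ι] (b : P.Base) : IsOpen (alcove b) := by
  have h : alcove b =
      ⋂ i, {v | b.IsPos i → 0 < ⟪P.root i, v⟫_ℝ ∧ ⟪P.root i, v⟫_ℝ < 1} := by
    ext v; simp [alcove]
  rw [h]
  refine isOpen_iInter_of_finite fun i ↦ ?_
  by_cases hi : b.IsPos i
  · simp only [hi, true_imp_iff]
    have hc : Continuous fun v : V ↦ ⟪P.root i, v⟫_ℝ := by fun_prop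
    exact (isOpen_lt continuous_const hc).inter (isOpen_lt hc continuous_const)
  · simp [hi]

theorem isBounded_alcove [Finite ι] [FiniteDimensional ℝ V] [P.IsRootSystem] (b : P.Base) :
    Bornology.IsBounded (alcove b) := by
  have := Fintype.ofFinite ι
  let L : V →ₗ[ℝ] (ι → ℝ) := LinearMap.pi fun i ↦ innerₗ V (P.root i)
  have hker : LinearMap.ker L = ⊥ := by
    refine (Submodule.eq_bot_iff _).mpr fun v hv ↦ ?_
    have hv' : ∀ i, ⟪P.root i, v⟫_ℝ = 0 := fun i ↦ congrFun (LinearMap.mem_ker.mp hv) i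
    have hspan : ∀ x ∈ Submodule.span ℝ (Set.range P.root), ⟪x, v⟫_ℝ = 0 := by
      intro x hx
      induction hx using Submodule.span_induction with
      | mem x hx => obtain ⟨i, rfl⟩ := hx; exact hv' i
      | zero => simp
      | add x y _ _ hx hy => simp [inner_add_left, hx, hy]
      | smul c x _ hx => simp [inner_smul_left, hx]
    rw [RootPairing.IsRootSystem.span_root_eq_top] at hspan
    exact inner_self_eq_zero.mp (hspan v trivial)
  obtain ⟨K, -, hK⟩ := L.exists_antilipschitzWith hker
  refine (hK.isBounded_preimage (Metric.isBounded_closedBall (x := 0) (r := 1))).subset ?_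
  intro v hv
  simp only [Set.mem_preimage, mem_closedBall_zero_iff]
  refine (pi_norm_le_iff_of_nonneg zero_le_one).mpr fun i ↦ ?_
  change |⟪P.root i, v⟫_ℝ| ≤ 1
  let := P.indexNeg
  rcases RootPairing.Base.IsPos.or_neg b i with hi | hi
  · have := hv i hi
    rw [abs_le]; constructor <;> linarith
  · have := hv _ hi
    have hneg : P.root (-i) = - P.root i := by simp
    rw [hneg, inner_neg_left] at this
    rw [abs_le]; constructor <;> linarith

/-- The automorphism group of a finite root system, and with it the Weyl group, is finite. -/
instance finite_weylGroup [Finite ι] [P.IsRootSystem] : Finite P.weylGroup := by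
  have : Function.Injective (fun g : P.weylGroup ↦ (g : P.Aut).indexEquiv) := by
    intro g h hgh
    refine Subtype.ext (RootPairing.Equiv.weightHom_injective P ?_)
    have key : ∀ x ∈ Submodule.span ℝ (Set.range P.root), (g : P.Aut) • x = (h : P.Aut) • x := by
      intro x hx
      induction hx using Submodule.span_induction with
      | mem x hx =>
        obtain ⟨i, rfl⟩ := hx
        rw [← RootPairing.Equiv.root_indexEquiv_eq_smul, ← RootPairing.Equiv.root_indexEquiv_eq_smul]
        exact congrArg (fun e : ι ≃ ι ↦ P.root (e i)) hgh
      | zero => simp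
      | add x y _ _ hx hy => simp [smul_add, hx, hy]
      | smul c x _ hx => 
        change RootPairing.Equiv.weightHom P g (c • x) = RootPairing.Equiv.weightHom P h (c • x)
        rw [map_smul, map_smul]
        exact congrArg (c • ·) hx
    rw [RootPairing.IsRootSystem.span_root_eq_top] at key
    exact LinearEquiv.ext fun x ↦ key x trivial
  exact Finite.of_injective _ this

/-- The symmetrised plane wave `φ⁰_μ(v) = (#W)⁻¹ ∑_{w ∈ W} exp (i ⟨w μ, v⟩)`. -/
def planeWave (P : RootPairing ι ℝ V V) (μ v : V) : ℂ :=
  (Nat.card P.weylGroup : ℂ)⁻¹ *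
    ∑ᶠ w : P.weylGroup, Complex.exp (Complex.I * (⟪w • μ, v⟫_ℝ : ℂ))

theorem contDiff_planeWave [Finite ι] [P.IsRootSystem] (μ : V) : ContDiff ℝ ∞ (planeWave P μ) := by
  have := Fintype.ofFinite P.weylGroup
  unfold planeWave
  simp only [finsum_eq_sum_of_fintype]
  refine contDiff_const.mul (ContDiff.sum fun w _ ↦ ?_)
  refine (contDiff_const.mul (Complex.ofRealCLM.contDiff.comp ?_)).cexp
  exact contDiff_const.inner ℝ contDiff_id

/-! ### The Laplacian on the alcove -/

variable [FiniteDimensional ℝ V] [MeasurableSpace V] [BorelSpace V]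

/-- The Hilbert space `L²(A)` of the alcove with the Euclidean measure. -/
abbrev L2 (b : P.Base) : Type _ := Lp ℂ 2 ((volume : Measure V).restrict (alcove b))

variable [Finite ι] [P.IsRootSystem]

theorem memLp_of_smooth (b : P.Base) (F : smoothFunctions V) :
    MemLp (F : V → ℂ) 2 ((volume : Measure V).restrict (alcove b)) := by
  have hF : ContDiff ℝ ∞ (F : V → ℂ) := F.2
  have hK : IsCompact (closure (alcove b)) := (isBounded_alcove b).isCompact_closure
  obtain ⟨C, hC⟩ := hK.exists_bound_of_continuousOn hF.continuous.continuousOn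
  have : IsFiniteMeasure ((volume : Measure V).restrict (alcove b)) :=
    isFiniteMeasure_restrict.mpr (isBounded_alcove b).measure_lt_top.ne
  refine MemLp.of_bound hF.continuous.aestronglyMeasurable C ?_
  exact (ae_restrict_iff' (isOpen_alcove b).measurableSet).mpr
    (.of_forall fun v hv ↦ hC v (subset_closure hv))

/-- The restriction `F ↦ F|_A` of smooth functions on `V` to the alcove, with values in `L²(A)`. -/
def restrict (b : P.Base) : smoothFunctions V →ₗ[ℂ] L2 b where
  toFun F := (memLp_of_smooth b F).toLp _
  map_add' _ _ := rfl
  map_smul' _ _ := rfl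

/-- The space `D₀` of restrictions of smooth `W^a`-invariant functions to the alcove. -/
def D₀ (b : P.Base) : Submodule ℂ (L2 b) :=
  (invariantSmoothFunctions P).map (restrict b)

/-- The restriction of `Δ F` depends only on the restriction of `F`. -/
theorem restrict_laplacian_eq_zero (b : P.Base) (F : smoothFunctions V) (h : restrict b F = 0) :
    restrict b (laplacian V F) = 0 := by
  have hF : ContDiff ℝ ∞ (F : V → ℂ) := F.2
  have h0 : (F : V → ℂ) =ᵐ[(volume : Measure V).restrict (alcove b)] 0 :=
    (MemLp.coeFn_toLp (memLp_of_smooth b F)).symm.trans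
      ((by rw [show (memLp_of_smooth b F).toLp _ = 0 from h]; exact Lp.coeFn_zero _ _ _))
  have h1 : Set.EqOn (F : V → ℂ) 0 (alcove b) :=
    Measure.eqOn_open_of_ae_eq h0 (isOpen_alcove b) hF.continuous.continuousOn continuousOn_const
  refine (MemLp.toLp_eq_toLp_iff (memLp_of_smooth b _) MemLp.zero).mpr ?_
  refine (ae_restrict_iff' (isOpen_alcove b).measurableSet).mpr (.of_forall fun v hv ↦ ?_)
  have h2 : (F : V → ℂ) =ᶠ[nhds v] (fun _ ↦ 0) :=
    Filter.eventually_of_mem ((isOpen_alcove b).mem_nhds hv) h1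
  have h3 := (InnerProductSpace.laplacian_congr_nhds h2).eq_of_nhds
  rw [InnerProductSpace.laplacian_const] at h3
  exact h3

/-- The operator `-Δ` on `L²(A)` with domain `D₀`, defined through its graph
`{(F|_A, -(ΔF)|_A) | F ∈ C^∞(V) invariant under W^a}`. -/
def negLaplacian (b : P.Base) : L2 b →ₗ.[ℂ] L2 b :=
  ((invariantSmoothFunctions P).map
    ((restrict b).prod (-(restrict b ∘ₗ laplacian V)))).toLinearPMap

theorem negLaplacian_graph (b : P.Base) : (negLaplacian b).graph =
    (invariantSmoothFunctions P).map ((restrict b).prod (-(restrict b ∘ₗ laplacian V))) := by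
  refine Submodule.toLinearPMap_graph_eq _ ?_
  rintro _ ⟨F, -, rfl⟩ h
  simpa using restrict_laplacian_eq_zero b F h

theorem negLaplacian_domain (b : P.Base) : (negLaplacian b).domain = D₀ b := by
  rw [negLaplacian, Submodule.toLinearPMap_domain, D₀, ← Submodule.map_comp]
  rfl

theorem negLaplacian_apply (b : P.Base) (F : smoothFunctions V)
    (hF : F ∈ invariantSmoothFunctions P) (h : restrict b F ∈ (negLaplacian b).domain) :
    negLaplacian b ⟨restrict b F, h⟩ = -restrict b (laplacian V F) := by
  have : (restrict b F, -restrict b (laplacian V F)) ∈ (negLaplacian b).graph := by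
    rw [negLaplacian_graph]
    exact ⟨F, hF, rfl⟩
  exact ((LinearPMap.image_iff h).mpr this).symm

/-- The plane wave `φ⁰_μ` as an element of `L²(A)`. -/
def planeWaveL2 (b : P.Base) (μ : V) : L2 b :=
  restrict b ⟨planeWave P μ, contDiff_planeWave μ⟩

end WeylAlcove

end

noncomputable section

namespace WeylAlcove

/-! ### The Weyl group acting by isometries -/

section WeylGroup

variable {ι V : Type*} [NormedAddCommGroup V] [InnerProductSpace ℝ V]
  (P : RootPairing ι ℝ V V)

/-! The alcove `A` is, up to a null set, a fundamental domain for `W^a`, so the union of its Weyl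
images is one for translations by `Q^∨`. Invariant smooth functions thus live on the torus `V/Q^∨`,
which has no boundary, and `#W` times their inner product over `A` is an integral over the torus.
Integration by parts has no boundary term, so `-Δ` is symmetric and positive
(`card_mul_inner_laplacian_left`).

For the fundamental domain, existence comes from an orbit point closest to a fixed point of `A`
(`exists_add_smul_mem_alcove`). For uniqueness (`eq_of_add_smul_mem_alcove`), the translation part
pairs with every root to -1, 0 or 1 and therefore vanishes (`eq_zero_of_abs_inner_root_le_one`); the
Weyl part is then trivial by the exchange condition.

The plane waves are eigenfunctions because the Weyl group preserves norms. They are orthogonal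
because nontrivial characters integrate to zero over the torus and distinct dominant weights lie in
distinct Weyl orbits. For completeness, a test function supported in `A` is summed over its
`W^a`-orbit and approximated uniformly by averaged trigonometric polynomials
(`eq_zero_of_forall_inner_planeWaveL2_eq_zero`).

The rest is abstract: if a symmetric operator has a Hilbert basis of eigenvectors in its domain, its
adjoint equals its closure (`adjoint_eq_closure`). This gives self-adjointness and uniqueness of the
extension; finitely many eigenvalues below each bound, counted with multiplicity, give compact
resolvents. -/

theorem weylGroup_ext [P.IsRootSystem] {w w' : P.weylGroup} (h : ∀ x : V, w • x = w' • x) :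
    w = w' :=
  Subtype.ext (RootPairing.Equiv.weightHom_injective P (LinearEquiv.ext h))

theorem weyl_smul_smul (w : P.weylGroup) (c : ℝ) (x : V) : w • (c • x) = c • (w • x) :=
  (RootPairing.Equiv.weightHom P w).map_smul c x

/-- The action of the Weyl group on the indices of the roots. -/
abbrev idx (w : P.weylGroup) (i : ι) : ι := P.weylGroupToPerm w i

theorem root_idx (w : P.weylGroup) (i : ι) : P.root (idx P w i) = w • P.root i :=
  (P.weylGroup_apply_root w i).symm

theorem idx_mul (w w' : P.weylGroup) (i : ι) : idx P (w * w') i = idx P w (idx P w' i) := by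
  simp [idx]

theorem idx_ofIdx (i j : ι) :
    idx P (RootPairing.weylGroup.ofIdx P i) j = P.reflectionPerm i j := rfl

variable [IsEuclidean P]

theorem reflection_apply_inner (i : ι) (x : V) :
    P.reflection i x = x - ⟪P.root i, x⟫_ℝ • P.coroot i := by
  rw [RootPairing.reflection_apply, show P.coroot' i x = P.toLinearMap x (P.coroot i) from rfl,
    IsEuclidean.pairing_eq_inner, IsEuclidean.coroot_eq, inner_smul_right, smul_smul,
    real_inner_comm, mul_comm]

theorem ofIdx_smul (i : ι) (x : V) :
    RootPairing.weylGroup.ofIdx P i • x = x - ⟪P.root i, x⟫_ℝ • P.coroot i :=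
  reflection_apply_inner P i x

theorem inner_root_coroot_self (i : ι) : ⟪P.root i, P.coroot i⟫_ℝ = 2 := by
  rw [← IsEuclidean.pairing_eq_inner (P := P), RootPairing.root_coroot_eq_pairing,
    RootPairing.pairing_same]

theorem root_norm_pos (i : ι) : 0 < ‖P.root i‖ := by
  refine norm_pos_iff.mpr fun h ↦ ?_
  have := inner_root_coroot_self P i
  simp [h] at this

theorem inner_coroot_left (i : ι) (x : V) :
    ⟪P.coroot i, x⟫_ℝ = 2 / ‖P.root i‖ ^ 2 * ⟪P.root i, x⟫_ℝ := by
  rw [IsEuclidean.coroot_eq (P := P), inner_smul_left]; rfl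

theorem coroot_factor_pos (i : ι) : 0 < 2 / ‖P.root i‖ ^ 2 := by
  have := root_norm_pos P i
  positivity

theorem exists_int_inner_root_coroot [P.IsCrystallographic] (i j : ι) :
    ∃ n : ℤ, ⟪P.root i, P.coroot j⟫_ℝ = n := by
  refine ⟨P.pairingIn ℤ i j, ?_⟩
  rw [← IsEuclidean.pairing_eq_inner (P := P), RootPairing.root_coroot_eq_pairing]
  exact (P.algebraMap_pairingIn ℤ i j).symm

theorem inner_weyl_smul_smul (w : P.weylGroup) (x y : V) : ⟪w • x, w • y⟫_ℝ = ⟪x, y⟫_ℝ := by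
  obtain ⟨g, hg⟩ := w
  revert x y
  induction hg using RootPairing.weylGroup.induction with
  | mem i =>
    intro x y
    change ⟪P.reflection i x, P.reflection i y⟫_ℝ = _
    have h := inner_root_coroot_self P i
    have hc := inner_coroot_left P i
    rw [reflection_apply_inner, reflection_apply_inner, inner_sub_left, inner_sub_right,
      inner_sub_right, inner_smul_left, inner_smul_right, inner_smul_left, inner_smul_right,
      hc, hc, ← real_inner_comm x (P.coroot i), hc, h]
    simp only [conj_trivial]
    ring
  | one => intro x y; rfl
  | mul g₁ g₂ hg₁ hg₂ h₁ h₂ =>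
    intro x y
    exact (h₁ _ _).trans (h₂ x y)

theorem norm_weyl_smul (w : P.weylGroup) (x : V) : ‖w • x‖ = ‖x‖ := by
  rw [norm_eq_sqrt_real_inner, inner_weyl_smul_smul, ← norm_eq_sqrt_real_inner]

theorem inner_weyl_smul_left (w : P.weylGroup) (x y : V) : ⟪w • x, y⟫_ℝ = ⟪x, w⁻¹ • y⟫_ℝ := by
  rw [← inner_weyl_smul_smul P w x, smul_inv_smul]

/-- An element of the Weyl group as a linear isometry. -/
def weylIsometry (w : P.weylGroup) : V ≃ₗᵢ[ℝ] V where
  toLinearEquiv := RootPairing.Equiv.weightHom P w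
  norm_map' := norm_weyl_smul P w

theorem coroot_idx (w : P.weylGroup) (i : ι) : P.coroot (idx P w i) = w • P.coroot i := by
  rw [IsEuclidean.coroot_eq (P := P), IsEuclidean.coroot_eq (P := P), root_idx, norm_weyl_smul,
    weyl_smul_smul]

theorem conj_ofIdx [P.IsRootSystem] (w : P.weylGroup) (i : ι) :
    w * RootPairing.weylGroup.ofIdx P i * w⁻¹ = RootPairing.weylGroup.ofIdx P (idx P w i) := by
  refine weylGroup_ext P fun x ↦ ?_
  rw [mul_smul, mul_smul, ofIdx_smul, ofIdx_smul, smul_sub, smul_inv_smul, weyl_smul_smul,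
    root_idx, coroot_idx, inner_weyl_smul_left]

theorem ofIdx_mul_self [P.IsRootSystem] (i : ι) :
    RootPairing.weylGroup.ofIdx P i * RootPairing.weylGroup.ofIdx P i = 1 := by
  refine weylGroup_ext P fun x ↦ ?_
  rw [mul_smul, ofIdx_smul, ofIdx_smul, one_smul, inner_sub_right, inner_smul_right,
    inner_root_coroot_self]
  module

theorem ofIdx_inv [P.IsRootSystem] (i : ι) :
    (RootPairing.weylGroup.ofIdx P i)⁻¹ = RootPairing.weylGroup.ofIdx P i :=
  inv_eq_of_mul_eq_one_left (ofIdx_mul_self P i)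

end WeylGroup

/-! ### Words in simple reflections and dominant vectors -/

section Words

variable {ι V : Type*} [Finite ι] [NormedAddCommGroup V] [InnerProductSpace ℝ V]
  {P : RootPairing ι ℝ V V} [IsEuclidean P] [P.IsRootSystem] [P.IsCrystallographic]
  [P.IsReduced] (b : P.Base)

/-- The product of a word in simple reflections. -/
def wordProd (l : List b.support) : P.weylGroup :=
  (l.map fun i ↦ RootPairing.weylGroup.ofIdx P i).prod

omit [Finite ι] [IsEuclidean P] [P.IsRootSystem] [P.IsCrystallographic] [P.IsReduced] in
theorem wordProd_cons (i : b.support) (l : List b.support) :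
    wordProd b (i :: l) = RootPairing.weylGroup.ofIdx P i * wordProd b l := by
  simp [wordProd]

/-- Every root arises from simple roots by negation and simple reflections. Negation does not change
the reflection, and a simple reflection conjugates it by a simple generator. -/
theorem exists_wordProd_eq_ofIdx (i : ι) :
    ∃ l, wordProd b l = RootPairing.weylGroup.ofIdx P i := by
  refine b.induction_reflect i (p := fun i ↦ ∃ l, wordProd b l = RootPairing.weylGroup.ofIdx P i)
    ?_ ?_ ?_
  · rintro i ⟨l, hl⟩
    refine ⟨l, ?_⟩
    rw [hl, ← idx_ofIdx, ← conj_ofIdx]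
    simp
  · intro i hi
    exact ⟨[⟨i, hi⟩], by simp [wordProd]⟩
  · rintro i j ⟨l, hl⟩ hj
    refine ⟨⟨j, hj⟩ :: (l ++ [⟨j, hj⟩]), ?_⟩
    rw [← idx_ofIdx, ← conj_ofIdx, ofIdx_inv, ← hl]
    simp [wordProd, mul_assoc]

theorem exists_wordProd_eq (w : P.weylGroup) : ∃ l, wordProd b l = w := by
  obtain ⟨g, hg⟩ := w
  induction hg using RootPairing.weylGroup.induction with
  | mem i => exact exists_wordProd_eq_ofIdx b i
  | one => exact ⟨[], rfl⟩
  | mul g₁ g₂ hg₁ hg₂ h₁ h₂ =>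
    obtain ⟨l₁, h₁⟩ := h₁
    obtain ⟨l₂, h₂⟩ := h₂
    refine ⟨l₁ ++ l₂, ?_⟩
    rw [← Submonoid.mk_mul_mk _ g₁ g₂ hg₁ hg₂]
    have : wordProd b (l₁ ++ l₂) = wordProd b l₁ * wordProd b l₂ := by simp [wordProd]
    rw [this, h₁, h₂]

/-- The exchange condition. -/
theorem exists_shorter_word (l : List b.support) (i : b.support)
    (h : ¬ b.IsPos (idx P (wordProd b l) i)) :
    ∃ l' : List b.support, l'.length + 1 = l.length ∧
      wordProd b l' = wordProd b l * RootPairing.weylGroup.ofIdx P i := by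
  induction l with
  | nil => exact absurd (RootPairing.Base.isPos_of_mem_support i.2) (by simpa [wordProd, idx] using h)
  | cons j l ih =>
    by_cases hl : b.IsPos (idx P (wordProd b l) i)
    -- The only positive root made negative by a simple reflection is its own simple root. So the
    -- sign changes at the letter `j` exactly because `wordProd b l` carries `i` to `j`, and that
    -- letter can be cancelled.
    · have hj : idx P (wordProd b l) i = j := by
        by_contra hne
        refine h ?_
        rw [wordProd_cons, idx_mul, idx_ofIdx]
        exact hl.reflectionPerm j.2 hne
      refine ⟨l, rfl, ?_⟩
      have := conj_ofIdx P (wordProd b l) i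
      rw [hj, mul_inv_eq_iff_eq_mul] at this
      rw [wordProd_cons, mul_assoc, this, ← mul_assoc, ofIdx_mul_self, one_mul]
    · obtain ⟨l', hl', h'⟩ := ih hl
      exact ⟨j :: l', by simp [hl'], by rw [wordProd_cons, wordProd_cons, h', mul_assoc]⟩

omit [P.IsRootSystem] [P.IsCrystallographic] [P.IsReduced] [IsEuclidean P] [Finite ι] in
theorem inner_root_nonpos_of_not_isPos {x : V} (hx : ∀ i, b.IsPos i → 0 ≤ ⟪P.root i, x⟫_ℝ) {i : ι}
    (hi : ¬ b.IsPos i) : ⟪P.root i, x⟫_ℝ ≤ 0 := by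
  let := P.indexNeg
  have := hx _ ((RootPairing.Base.IsPos.neg_iff_not b i).mpr hi)
  rw [show P.root (-i) = - P.root i by simp, inner_neg_left] at this
  linarith

/-- Induction on word length, looking at the last letter `i` of a word for `w`. If `w` sends this
simple root to a positive root, the prefix sends it to a negative one, and the exchange condition
yields a word for `w` shorter by two. Otherwise dominance of `w • x` gives `⟪P.root i, x⟫ ≤ 0`,
hence equality, so the reflection fixes `x` and the letter can be dropped; strict dominance excludes
this case. -/
theorem wordProd_smul_eq_of_dominant (l : List b.support) (x : V)
    (hx : ∀ i, b.IsPos i → 0 ≤ ⟪P.root i, x⟫_ℝ)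
    (hlx : ∀ i, b.IsPos i → 0 ≤ ⟪P.root i, wordProd b l • x⟫_ℝ) :
    wordProd b l • x = x ∧
      ((∀ i, b.IsPos i → 0 < ⟪P.root i, wordProd b l • x⟫_ℝ) → wordProd b l = 1) := by
  obtain ⟨n, hn⟩ : ∃ n, l.length = n := ⟨_, rfl⟩
  induction n using Nat.strong_induction_on generalizing l with
  | _ n ih =>
  rcases l.eq_nil_or_concat with rfl | ⟨l', i, rfl⟩
  · simp [wordProd]
  have hw : wordProd b (l'.concat i) = wordProd b l' * RootPairing.weylGroup.ofIdx P i := by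
    simp [wordProd]
  have hlen : l'.length < n := by rw [← hn]; simp
  by_cases hpos : b.IsPos (idx P (wordProd b (l'.concat i)) i)
  · have hneg : ¬ b.IsPos (idx P (wordProd b l') i) := by
      let := P.indexNeg
      rw [hw, idx_mul, idx_ofIdx, RootPairing.Base.isPos_iff] at hpos
      have h1 : P.root (idx P (wordProd b l') (P.reflectionPerm i i)) =
          P.root (-(idx P (wordProd b l') i)) := by
        rw [root_idx, RootPairing.root_reflectionPerm, RootPairing.reflection_apply_self, smul_neg,
          ← root_idx]
        simp
      rw [P.root.injective h1, ← RootPairing.Base.isPos_iff,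
        RootPairing.Base.IsPos.neg_iff_not] at hpos
      exact hpos
    obtain ⟨l'', hl'', h''⟩ := exists_shorter_word b l' i hneg
    rw [hw, ← h''] at hlx ⊢
    exact ih _ (by omega) l'' hlx rfl
  · have h0 : ⟪P.root (idx P (wordProd b (l'.concat i)) i), wordProd b (l'.concat i) • x⟫_ℝ =
        ⟪P.root i, x⟫_ℝ := by
      rw [root_idx, inner_weyl_smul_smul]
    have h1 := inner_root_nonpos_of_not_isPos b hlx hpos
    have h2 := hx i (RootPairing.Base.isPos_of_mem_support i.2)
    have h3 : ⟪P.root i, x⟫_ℝ = 0 := le_antisymm (h0 ▸ h1) h2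
    have h4 : wordProd b (l'.concat i) • x = wordProd b l' • x := by
      rw [hw, mul_smul, ofIdx_smul, h3, zero_smul, sub_zero]
    rw [h4] at hlx
    refine ⟨h4 ▸ (ih _ hlen l' hlx rfl).1, fun hs ↦ ?_⟩
    have h5 : ∀ i, b.IsPos i → 0 < ⟪P.root i, x⟫_ℝ := by
      rw [h4, (ih _ hlen l' hlx rfl).1] at hs
      exact hs
    exact absurd (h5 i (RootPairing.Base.isPos_of_mem_support i.2)) h3.not_gt

theorem weyl_smul_eq_of_dominant (w : P.weylGroup) (x : V)
    (hx : ∀ i, b.IsPos i → 0 ≤ ⟪P.root i, x⟫_ℝ)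
    (hwx : ∀ i, b.IsPos i → 0 ≤ ⟪P.root i, w • x⟫_ℝ) : w • x = x := by
  obtain ⟨l, rfl⟩ := exists_wordProd_eq b w
  exact (wordProd_smul_eq_of_dominant b l x hx hwx).1

theorem eq_one_of_strictly_dominant (w : P.weylGroup) (x : V)
    (hx : ∀ i, b.IsPos i → 0 < ⟪P.root i, x⟫_ℝ)
    (hwx : ∀ i, b.IsPos i → 0 < ⟪P.root i, w • x⟫_ℝ) : w = 1 := by
  obtain ⟨l, rfl⟩ := exists_wordProd_eq b w
  exact (wordProd_smul_eq_of_dominant b l x (fun i hi ↦ (hx i hi).le)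
    (fun i hi ↦ (hwx i hi).le)).2 hwx

end Words

end WeylAlcove

/-! ### Discreteness of lattices and the coroot lattice -/

namespace WeylAlcove

/-- The pairings with a spanning family determine `x`; here they are integers bounded by
Cauchy–Schwarz. The floor only turns them into an integer-valued map defined on all of `V`. -/
theorem finite_norm_le_of_inner_int {κ V : Type*} [Finite κ] [NormedAddCommGroup V]
    [InnerProductSpace ℝ V] (u : κ → V) (hu : Submodule.span ℝ (Set.range u) = ⊤) (C : ℝ) :
    {x : V | ‖x‖ ≤ C ∧ ∀ k, ∃ n : ℤ, ⟪u k, x⟫_ℝ = n}.Finite := by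
  classical
  have := Fintype.ofFinite κ
  obtain ⟨M, hM⟩ := (Set.finite_range fun k ↦ ‖u k‖).bddAbove
  have hM' : ∀ k, ‖u k‖ ≤ M := fun k ↦ hM ⟨k, rfl⟩
  let f : V → κ → ℤ := fun x k ↦ ⌊⟪u k, x⟫_ℝ⌋
  refine Set.Finite.of_finite_image (f := f)
    ((Set.finite_Icc (fun _ ↦ -⌈M * C⌉) (fun _ ↦ ⌈M * C⌉)).subset ?_) ?_
  · rintro _ ⟨x, ⟨hx, hk⟩, rfl⟩
    have key : ∀ k, |⌊⟪u k, x⟫_ℝ⌋| ≤ ⌈M * C⌉ := by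
      intro k
      obtain ⟨n, hn⟩ := hk k
      rw [hn, Int.floor_intCast]
      have h1 : |(n : ℝ)| ≤ M * C := by
        rw [← hn]
        exact (abs_real_inner_le_norm _ _).trans
          (mul_le_mul (hM' k) hx (norm_nonneg _) ((norm_nonneg _).trans (hM' k)))
      have h2 : ((|n| : ℤ) : ℝ) ≤ (⌈M * C⌉ : ℤ) := by
        push_cast
        exact h1.trans (Int.le_ceil _)
      exact_mod_cast h2
    exact ⟨fun k ↦ (abs_le.mp (key k)).1, fun k ↦ (abs_le.mp (key k)).2⟩
  · rintro x ⟨-, hx⟩ y ⟨-, hy⟩ hxy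
    have h0 : ∀ k, ⟪u k, x - y⟫_ℝ = 0 := by
      intro k
      obtain ⟨n, hn⟩ := hx k
      obtain ⟨m, hm⟩ := hy k
      have := congrFun hxy k
      simp only [f, hn, hm, Int.floor_intCast] at this
      rw [inner_sub_right, hn, hm, this, sub_self]
    have hspan : ∀ z ∈ Submodule.span ℝ (Set.range u), ⟪z, x - y⟫_ℝ = 0 := by
      intro z hz
      induction hz using Submodule.span_induction with
      | mem z hz => obtain ⟨i, rfl⟩ := hz; exact h0 i
      | zero => simp
      | add a c _ _ ha hc => simp [inner_add_left, ha, hc]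
      | smul c a _ ha => simp [inner_smul_left, ha]
    rw [hu] at hspan
    exact sub_eq_zero.mp (inner_self_eq_zero.mp (hspan _ trivial))

section Lattice

variable {ι V : Type*} [NormedAddCommGroup V] [InnerProductSpace ℝ V]
  (P : RootPairing ι ℝ V V)

/-- The lattice generated by the coroots. -/
def corootLattice : AddSubgroup V := AddSubgroup.closure (Set.range P.coroot)

theorem coroot_mem_corootLattice (i : ι) : P.coroot i ∈ corootLattice P :=
  AddSubgroup.subset_closure ⟨i, rfl⟩

/-- Coroots are closed under negation, so lattice vectors are plain sums of lists of coroots. This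
permits induction on the length of the list. -/
theorem corootLattice_eq_addSubmonoid_closure :
    (corootLattice P).toAddSubmonoid = AddSubmonoid.closure (Set.range P.coroot) := by
  rw [corootLattice, AddSubgroup.closure_toAddSubmonoid]
  congr 1
  refine Set.union_eq_left.mpr ?_
  rintro x ⟨i, hi⟩
  exact ⟨P.reflectionPerm i i, by
    rw [P.coroot_reflectionPerm, P.coreflection_apply_self, hi, neg_neg]⟩

variable [IsEuclidean P]

theorem exists_int_inner_root [P.IsCrystallographic] (i : ι) {q : V} (hq : q ∈ corootLattice P) :
    ∃ n : ℤ, ⟪P.root i, q⟫_ℝ = n := by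
  induction hq using AddSubgroup.closure_induction with
  | mem x hx => obtain ⟨j, rfl⟩ := hx; exact exists_int_inner_root_coroot P i j
  | zero => exact ⟨0, by simp⟩
  | add x y _ _ hx hy =>
    obtain ⟨n, hn⟩ := hx
    obtain ⟨m, hm⟩ := hy
    exact ⟨n + m, by simp [inner_add_right, hn, hm]⟩
  | neg x _ hx =>
    obtain ⟨n, hn⟩ := hx
    exact ⟨-n, by simp [hn]⟩

theorem weyl_smul_mem_corootLattice (w : P.weylGroup) {q : V} (hq : q ∈ corootLattice P) :
    w • q ∈ corootLattice P := by
  induction hq using AddSubgroup.closure_induction with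
  | mem x hx =>
    obtain ⟨j, rfl⟩ := hx
    rw [← coroot_idx]
    exact coroot_mem_corootLattice P _
  | zero => rw [smul_zero]; exact zero_mem _
  | add x y _ _ hx hy => rw [smul_add]; exact add_mem hx hy
  | neg x _ hx => rw [smul_neg]; exact neg_mem hx

/-- A minuscule vector of the coroot lattice vanishes. -/
theorem eq_zero_of_abs_inner_root_le_one [P.IsCrystallographic] {q : V} (hq : q ∈ corootLattice P)
    (h : ∀ i, |⟪P.root i, q⟫_ℝ| ≤ 1) : q = 0 := by
  have hq' : q ∈ AddSubmonoid.closure (Set.range P.coroot) := by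
    rw [← corootLattice_eq_addSubmonoid_closure]; exact hq
  obtain ⟨l, hl, rfl⟩ := AddSubmonoid.exists_list_of_mem_closure hq'
  clear hq'
  obtain ⟨n, hn⟩ : ∃ n, l.length = n := ⟨_, rfl⟩
  induction n generalizing l with
  | zero => rw [List.length_eq_zero_iff.mp hn]; rfl
  | succ n ih =>
    by_contra hne
    -- Otherwise the sum would have nonpositive inner product with itself.
    have hpos : ∃ y ∈ l, 0 < ⟪y, l.sum⟫_ℝ := by
      by_contra! hcon
      have h1 : ∀ l' : List V, (∀ y ∈ l', ⟪y, l.sum⟫_ℝ ≤ 0) → ⟪l'.sum, l.sum⟫_ℝ ≤ 0 := by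
        intro l' h'
        induction l' with
        | nil => simp
        | cons a l' ih' =>
          rw [List.sum_cons, inner_add_left]
          have := h' a (by simp)
          have := ih' fun y hy ↦ h' y (by simp [hy])
          linarith
      exact hne (inner_self_eq_zero.mp (le_antisymm (h1 l hcon) real_inner_self_nonneg))
    obtain ⟨y, hy, hypos⟩ := hpos
    obtain ⟨i, rfl⟩ := hl y hy
    have hi : ⟪P.root i, l.sum⟫_ℝ = 1 := by
      obtain ⟨m, hm⟩ := exists_int_inner_root P i hq
      have h1 := h i
      rw [inner_coroot_left] at hypos
      have h2 := pos_of_mul_pos_right hypos (coroot_factor_pos P i).le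
      rw [hm] at h1 h2 ⊢
      have h3 : 0 < m := by exact_mod_cast h2
      have h4 : |m| ≤ 1 := by exact_mod_cast h1
      have h5 := (abs_le.mp h4).2
      exact_mod_cast (by omega : m = 1)
    obtain ⟨l', hp⟩ : ∃ l', l.Perm (P.coroot i :: l') := by
      classical
      exact ⟨l.erase (P.coroot i), List.perm_cons_erase hy⟩
    have hsum : l.sum = P.coroot i + l'.sum := by rw [hp.sum_eq, List.sum_cons]
    -- Since the pairing is exactly 1, the reflection subtracts one copy of the coroot. The
    -- reflected vector satisfies the same bounds and is a shorter sum, so the induction hypothesis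
    -- applies to it.
    have hrefl : RootPairing.weylGroup.ofIdx P i • l.sum = l'.sum := by
      rw [ofIdx_smul, hi, hsum]; module
    have hzero := ih l' (fun y hy ↦ hl y (hp.mem_iff.mpr (by simp [hy])))
      (hrefl ▸ weyl_smul_mem_corootLattice P _ hq)
      (fun j ↦ by
        rw [← hrefl, ← inv_inv (RootPairing.weylGroup.ofIdx P i), ← inner_weyl_smul_left,
          ← root_idx]
        exact h _)
      (by have := hp.length_eq; simp at this; omega)
    rw [hzero] at hrefl
    refine hne (norm_eq_zero.mp ?_)
    rw [← norm_weyl_smul P (RootPairing.weylGroup.ofIdx P i), hrefl, norm_zero]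

end Lattice

/-! ### The alcove meets almost every affine Weyl orbit exactly once -/

section Alcove

variable {ι V : Type*} [Finite ι] [NormedAddCommGroup V] [InnerProductSpace ℝ V]
  {P : RootPairing ι ℝ V V} [P.IsCrystallographic] (b : P.Base)

theorem inner_root_pos_of_simple {x : V} (hx : ∀ i ∈ b.support, 0 < ⟪P.root i, x⟫_ℝ) {i : ι}
    (hi : b.IsPos i) : 0 < ⟪P.root i, x⟫_ℝ := by
  refine hi.induction_on_add (p := fun i ↦ 0 < ⟪P.root i, x⟫_ℝ) hx fun j k l h hj hk ↦ ?_
  rw [h, inner_add_left]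
  have := hx k hk
  linarith

variable [FiniteDimensional ℝ V] [P.IsRootSystem]

theorem exists_mem_alcove : ∃ a, a ∈ alcove b := by
  -- `a` pairs to 1 with every simple root, hence positively with every positive root; a small
  -- positive multiple of it lies in the alcove.
  let f : V →ₗ[ℝ] ℝ := b.toWeightBasis.constr ℝ fun _ ↦ (1 : ℝ)
  let a : V := (InnerProductSpace.toDual ℝ V).symm f.toContinuousLinearMap
  have ha : ∀ i ∈ b.support, 0 < ⟪P.root i, a⟫_ℝ := by
    intro i hi
    rw [real_inner_comm, InnerProductSpace.toDual_symm_apply]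
    have h : P.root i = b.toWeightBasis ⟨i, hi⟩ := by simp
    rw [LinearMap.coe_toContinuousLinearMap', h, Module.Basis.constr_basis]
    exact one_pos
  obtain ⟨M, hM⟩ := (Set.finite_range fun i ↦ ⟪P.root i, a⟫_ℝ).bddAbove
  have hM' : ∀ i, ⟪P.root i, a⟫_ℝ ≤ M := fun i ↦ hM ⟨i, rfl⟩
  refine ⟨(|M| + 1)⁻¹ • a, fun i hi ↦ ?_⟩
  have h1 := inner_root_pos_of_simple b ha hi
  have h2 : 0 < |M| + 1 := by positivity
  rw [inner_smul_right]
  refine ⟨by positivity, ?_⟩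
  rw [inv_mul_lt_iff₀ h2]
  have := hM' i
  have := le_abs_self M
  linarith

theorem zero_mem_closure_alcove : (0 : V) ∈ closure (alcove b) := by
  obtain ⟨a, ha⟩ := exists_mem_alcove b
  have h : Filter.Tendsto (fun t : ℝ ↦ t • a) (nhdsWithin 0 (Set.Ioi 0)) (nhds 0) := by
    have : Continuous fun t : ℝ ↦ t • a := by fun_prop
    have h := this.tendsto 0
    rw [zero_smul] at h
    exact h.mono_left nhdsWithin_le_nhds
  refine mem_closure_of_tendsto h ?_
  filter_upwards [Ioo_mem_nhdsGT (zero_lt_one (α := ℝ))] with t ht i hi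
  have := ha i hi
  rw [inner_smul_right]
  exact ⟨mul_pos ht.1 this.1, by nlinarith [ht.1, ht.2]⟩

variable [IsEuclidean P]

omit [Finite ι] [P.IsCrystallographic] [FiniteDimensional ℝ V] [P.IsRootSystem] [IsEuclidean P] in
theorem inner_root_mem_Ioo_of_mem_alcove {v : V} (hv : v ∈ alcove b) (i : ι) :
    -1 < ⟪P.root i, v⟫_ℝ ∧ ⟪P.root i, v⟫_ℝ < 1 := by
  let := P.indexNeg
  rcases RootPairing.Base.IsPos.or_neg b i with hi | hi
  · have := hv i hi
    constructor <;> linarith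
  · have := hv _ hi
    rw [show P.root (-i) = - P.root i by simp, inner_neg_left] at this
    constructor <;> linarith

omit [FiniteDimensional ℝ V] in
/-- Distinct elements of the affine Weyl group map the alcove to disjoint sets. -/
theorem eq_of_add_smul_mem_alcove [P.IsReduced] {v q : V} {w : P.weylGroup} (hv : v ∈ alcove b)
    (hq : q ∈ corootLattice P) (h : q + w • v ∈ alcove b) : q = 0 ∧ w = 1 := by
  -- Each pairing of a root with `q` is an integer and a difference of two numbers in `(-1, 1)`,
  -- hence at most 1 in absolute value.
  have hq0 : q = 0 := by
    refine eq_zero_of_abs_inner_root_le_one P hq fun i ↦ ?_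
    obtain ⟨n, hn⟩ := exists_int_inner_root P i hq
    have h1 := inner_root_mem_Ioo_of_mem_alcove b h i
    have h2 := inner_root_mem_Ioo_of_mem_alcove b hv (idx P w⁻¹ i)
    rw [root_idx, inner_weyl_smul_left, inv_inv] at h2
    rw [inner_add_right, hn] at h1
    rw [hn]
    have h3 : (n : ℝ) < 2 := by linarith
    have h4 : (-2 : ℝ) < n := by linarith
    have h5 : n < 2 := by exact_mod_cast h3
    have h6 : -2 < n := by exact_mod_cast h4
    have h7 : |n| ≤ 1 := abs_le.mpr ⟨by omega, by omega⟩
    exact_mod_cast h7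
  rw [hq0, zero_add] at h
  exact ⟨hq0, eq_one_of_strictly_dominant b w v (fun i hi ↦ (hv i hi).1) fun i hi ↦ (h i hi).1⟩

omit [FiniteDimensional ℝ V] in
theorem finite_corootLattice_norm_le (C : ℝ) : {q | q ∈ corootLattice P ∧ ‖q‖ ≤ C}.Finite :=
  (finite_norm_le_of_inner_int P.root RootPairing.IsRootSystem.span_root_eq_top C).subset
    fun _ hq ↦ ⟨hq.2, fun i ↦ exists_int_inner_root P i hq.1⟩

/-- A vector that lies on none of the affine root hyperplanes has an image in the alcove. -/
theorem exists_add_smul_mem_alcove {v : V} (hv : ∀ i, ∀ n : ℤ, ⟪P.root i, v⟫_ℝ ≠ n) :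
    ∃ q ∈ corootLattice P, ∃ w : P.weylGroup, q + w • v ∈ alcove b := by
  obtain ⟨a, ha⟩ := exists_mem_alcove b
  -- A translation part longer than this bound puts the image of `v` farther from `a` than `v`
  -- itself. A minimum over this finite set is therefore a minimum over the whole orbit.
  let s : Set (V × P.weylGroup) :=
    {q | q ∈ corootLattice P ∧ ‖q‖ ≤ ‖v - a‖ + ‖v‖ + ‖a‖} ×ˢ Set.univ
  have hs : s.Finite := (finite_corootLattice_norm_le _).prod Set.finite_univ
  have h0 : ((0 : V), (1 : P.weylGroup)) ∈ s := by
    refine ⟨⟨zero_mem _, ?_⟩, trivial⟩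
    rw [norm_zero]; positivity
  obtain ⟨⟨q, w⟩, hqw, hmin⟩ := s.exists_min_image (fun p ↦ ‖p.1 + p.2 • v - a‖) hs ⟨_, h0⟩
  have hmin' : ∀ q' ∈ corootLattice P, ∀ w' : P.weylGroup,
      ‖q + w • v - a‖ ≤ ‖q' + w' • v - a‖ := by
    intro q' hq' w'
    by_cases hn : ‖q'‖ ≤ ‖v - a‖ + ‖v‖ + ‖a‖
    · exact hmin (q', w') ⟨⟨hq', hn⟩, trivial⟩
    · have h1 := hmin _ h0
      simp only [zero_add, one_smul] at h1
      have h2 : ‖q'‖ ≤ ‖q' + w' • v - a‖ + ‖w' • v‖ + ‖a‖ := by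
        have : q' = (q' + w' • v - a) - w' • v + a := by abel
        calc ‖q'‖ = ‖(q' + w' • v - a) - w' • v + a‖ := congrArg _ this
          _ ≤ ‖(q' + w' • v - a) - w' • v‖ + ‖a‖ := norm_add_le _ _
          _ ≤ _ := by gcongr; exact norm_sub_le _ _
      rw [norm_weyl_smul] at h2
      linarith
  have hq : q ∈ corootLattice P := hqw.1.1
  refine ⟨q, hq, w, ?_⟩
  set u := q + w • v with hu
  clear_value u
  have hreg : ∀ i, ∀ n : ℤ, ⟪P.root i, u⟫_ℝ ≠ n := by
    intro i n hn
    obtain ⟨m, hm⟩ := exists_int_inner_root P i hq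
    refine hv (idx P w⁻¹ i) (n - m) ?_
    rw [root_idx, inner_weyl_smul_left, inv_inv]
    rw [hu, inner_add_right, hm] at hn
    push_cast
    linarith
  -- moving `u` by an affine reflection does not bring it closer to `a`
  have hstep : ∀ i, ∀ k : ℤ, 0 ≤ (⟪P.root i, u⟫_ℝ - k) * (⟪P.root i, a⟫_ℝ - k) := by
    intro i k
    have hmem : RootPairing.weylGroup.ofIdx P i • q + k • P.coroot i ∈ corootLattice P :=
      add_mem (weyl_smul_mem_corootLattice P _ hq) (zsmul_mem (coroot_mem_corootLattice P i) k)
    have h1 := hmin' _ hmem (RootPairing.weylGroup.ofIdx P i * w)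
    have h2 : RootPairing.weylGroup.ofIdx P i • q + k • P.coroot i +
        (RootPairing.weylGroup.ofIdx P i * w) • v - a =
        (u - a) - (⟪P.root i, u⟫_ℝ - k) • P.coroot i := by
      rw [mul_smul, add_right_comm, ← smul_add, ← hu, ofIdx_smul, ← Int.cast_smul_eq_zsmul ℝ k]
      module
    rw [h2] at h1
    -- With `c = 2 / ‖P.root i‖ ^ 2`, the reflection changes the squared distance to `a` by `2 * c`
    -- times the product in the claim.
    have h3 := pow_le_pow_left₀ (norm_nonneg _) h1 2
    rw [norm_sub_sq_real (u - a), inner_smul_right, norm_smul, mul_pow, Real.norm_eq_abs, sq_abs,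
      real_inner_comm (P.coroot i), inner_coroot_left, inner_sub_right,
      ← real_inner_self_eq_norm_sq (P.coroot i),
      inner_coroot_left, inner_root_coroot_self] at h3
    have h4 := coroot_factor_pos P i
    by_contra! hneg
    nlinarith [mul_pos_of_neg_of_neg hneg (neg_lt_zero.mpr h4)]
  intro i hi
  have hai := ha i hi
  -- The walls of the alcove are among the hyperplanes with `k = 0` and `k = 1`; regularity excludes
  -- that `u` lies on them, so `u` is on the same side as `a`.
  have h0 := hstep i 0
  have h1 := hstep i 1
  have hr0 := hreg i 0
  have hr1 := hreg i 1
  simp only [Int.cast_zero, sub_zero, Int.cast_one] at h0 h1 hr0 hr1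
  constructor
  · rcases lt_or_gt_of_ne hr0 with h | h
    · nlinarith
    · exact h
  · rcases lt_or_gt_of_ne hr1 with h | h
    · exact h
    · nlinarith

end Alcove

end WeylAlcove

/-! ### Affine Weyl invariance in terms of `W` and `Q^∨` -/

namespace WeylAlcove

section Invariance

variable {ι V : Type*} [NormedAddCommGroup V] [InnerProductSpace ℝ V]
  {P : RootPairing ι ℝ V V}

theorem mem_invariantSmoothFunctions_iff {F : smoothFunctions V} :
    F ∈ invariantSmoothFunctions P ↔
      (∀ (w : P.weylGroup) (v : V), (F : V → ℂ) (w • v) = (F : V → ℂ) v) ∧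
        ∀ q ∈ corootLattice P, ∀ v : V, (F : V → ℂ) (q + v) = (F : V → ℂ) v := by
  constructor
  · intro hF
    constructor
    · rintro ⟨g, hg⟩
      induction hg using RootPairing.weylGroup.induction with
      | mem i => exact fun v ↦ hF _ (Subgroup.subset_closure (.inl ⟨i, rfl⟩)) v
      | one => exact fun v ↦ rfl
      | mul g₁ g₂ hg₁ hg₂ h₁ h₂ => exact fun v ↦ (h₁ _).trans (h₂ v)
    · intro q hq
      induction hq using AddSubgroup.closure_induction with
      | mem x hx =>
        obtain ⟨j, rfl⟩ := hx
        exact fun v ↦ hF _ (Subgroup.subset_closure (.inr ⟨j, rfl⟩)) v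
      | zero => simp
      | add x y _ _ hx hy => intro v; rw [add_assoc, hx, hy]
      | neg x _ hx => intro v; rw [← hx (-x + v), add_neg_cancel_left]
  · rintro ⟨hW, hL⟩ w hw
    induction hw using Subgroup.closure_induction with
    | mem x hx =>
      rcases hx with ⟨i, rfl⟩ | ⟨i, rfl⟩
      · exact hW (RootPairing.weylGroup.ofIdx P i)
      · exact hL _ (coroot_mem_corootLattice P i)
    | one => exact fun v ↦ rfl
    | mul x y _ _ hx hy => exact fun v ↦ (hx (y v)).trans (hy v)
    | inv x _ hx =>
      intro v
      rw [← hx (x⁻¹ v)]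
      exact congrArg _ (AffineEquiv.apply_symm_apply x v)

end Invariance

/-! ### A fundamental domain for the coroot lattice and integration over it -/

section Domain

variable {ι V : Type*} [NormedAddCommGroup V] [InnerProductSpace ℝ V]
  {P : RootPairing ι ℝ V V} (b : P.Base)

/-- The union of the images of the alcove under the Weyl group. -/
def weylDomain : Set V := ⋃ w : P.weylGroup, (fun v ↦ w • v) ⁻¹' alcove b

variable [IsEuclidean P]

theorem continuous_weyl_smul (w : P.weylGroup) : Continuous fun v : V ↦ w • v :=
  (weylIsometry P w).continuous

variable [Finite ι]

theorem isOpen_weylDomain : IsOpen (weylDomain b) :=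
  isOpen_iUnion fun w ↦ (isOpen_alcove b).preimage (continuous_weyl_smul w)

variable [FiniteDimensional ℝ V] [P.IsRootSystem]

theorem isBounded_weylDomain : Bornology.IsBounded (weylDomain b) := by
  obtain ⟨C, hC⟩ := (isBounded_alcove b).exists_norm_le
  refine isBounded_iff_forall_norm_le.mpr ⟨C, fun v hv ↦ ?_⟩
  obtain ⟨w, hw⟩ := Set.mem_iUnion.mp hv
  rw [← norm_weyl_smul P w]
  exact hC _ hw

variable [MeasurableSpace V] [BorelSpace V]

omit [FiniteDimensional ℝ V] [P.IsRootSystem] [Finite ι] in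
theorem measurePreserving_weyl_smul [FiniteDimensional ℝ V] (w : P.weylGroup) :
    MeasurePreserving (fun v : V ↦ w • v) :=
  (weylIsometry P w).measurePreserving

omit [P.IsRootSystem] in
theorem ae_forall_inner_root_ne_int :
    ∀ᵐ v : V, ∀ i, ∀ n : ℤ, ⟪P.root i, v⟫_ℝ ≠ n := by
  rw [ae_all_iff]
  intro i
  rw [ae_all_iff]
  intro n
  let s : AffineSubspace ℝ V :=
    { carrier := {v | ⟪P.root i, v⟫_ℝ = n}
      smul_vsub_vadd_mem' := by
        intro c x y z hx hy hz
        simp only [Set.mem_ofPred_eq] at *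
        rw [vadd_eq_add, vsub_eq_sub, inner_add_right, inner_smul_right, inner_sub_right, hx, hy,
          hz]
        ring }
  -- The pairing takes the values 0 at the origin and 2 at the coroot, so it is not constant.
  have hs : s ≠ ⊤ := by
    intro h
    have h0 : (0 : V) ∈ s := h ▸ AffineSubspace.mem_top ℝ V 0
    have h1 : P.coroot i ∈ s := h ▸ AffineSubspace.mem_top ℝ V _
    have h0' : ⟪P.root i, (0 : V)⟫_ℝ = n := h0
    have h1' : ⟪P.root i, P.coroot i⟫_ℝ = n := h1
    rw [inner_root_coroot_self, ← h0', inner_zero_right] at h1'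
    norm_num at h1'
  have := Measure.addHaar_affineSubspace (volume : Measure V) s hs
  rw [ae_iff]
  simp only [ne_eq, not_not]
  exact this

variable [P.IsCrystallographic]

instance countable_corootLattice : Countable (corootLattice P) := by
  have h : ((corootLattice P : AddSubgroup V) : Set V) =
      ⋃ n : ℕ, {q | q ∈ corootLattice P ∧ ‖q‖ ≤ n} := by
    ext q
    simp only [SetLike.mem_coe, Set.mem_iUnion, Set.mem_ofPred_eq, exists_and_left,
      iff_self_and]
    exact fun _ ↦ exists_nat_ge _
  have h' : ((corootLattice P : AddSubgroup V) : Set V).Countable := by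
    rw [h]
    exact Set.countable_iUnion fun n ↦ (finite_corootLattice_norm_le _).countable
  exact h'.to_subtype

variable [P.IsReduced]

/-- Since `W` normalises the lattice, existence and uniqueness for `W^a` acting on the alcove become
covering and disjointness for lattice translates of the Weyl images of the alcove. -/
theorem isAddFundamentalDomain_weylDomain :
    IsAddFundamentalDomain (corootLattice P) (weylDomain b) (volume : Measure V) where
  nullMeasurableSet := (isOpen_weylDomain b).measurableSet.nullMeasurableSet
  ae_covers := by
    filter_upwards [ae_forall_inner_root_ne_int (P := P)] with v hv
    obtain ⟨q, hq, w, h⟩ := exists_add_smul_mem_alcove b hv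
    refine ⟨⟨w⁻¹ • q, weyl_smul_mem_corootLattice P _ hq⟩, Set.mem_iUnion.mpr ⟨w, ?_⟩⟩
    change w • (w⁻¹ • q + v) ∈ alcove b
    rwa [smul_add, smul_inv_smul]
  aedisjoint := by
    intro g g' hne
    refine Disjoint.aedisjoint (Set.disjoint_left.mpr ?_)
    rintro x ⟨y, hy, rfl⟩ ⟨y', hy', h⟩
    obtain ⟨w, hw⟩ := Set.mem_iUnion.mp hy
    obtain ⟨w', hw'⟩ := Set.mem_iUnion.mp hy'
    have h : (g' : V) + y' = g + y := h
    have h1 : w' • y' = w' • ((g : V) - g') + (w' * w⁻¹) • (w • y) := by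
      rw [mul_smul, inv_smul_smul, ← smul_add]
      congr 1
      rw [sub_add_eq_add_sub, ← h, add_sub_cancel_left]
    have h2 : w' • y' ∈ alcove b := hw'
    rw [h1] at h2
    have h3 := (eq_of_add_smul_mem_alcove b hw
      (weyl_smul_mem_corootLattice P w' (sub_mem g.2 g'.2)) h2).1
    rw [smul_eq_zero_iff_eq, sub_eq_zero] at h3
    exact hne (Subtype.ext h3)

theorem integrableOn_of_continuous {F : V → ℂ} (hF : Continuous F) {s : Set V}
    (hs : Bornology.IsBounded s) : IntegrableOn F s :=
  (hF.continuousOn.integrableOn_compact hs.isCompact_closure).mono_set subset_closure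

/-- The domain is a disjoint union of `#W` isometric copies of the alcove. -/
theorem setIntegral_weylDomain {F : V → ℂ} (hF : Continuous F)
    (hW : ∀ (w : P.weylGroup) (v : V), F (w • v) = F v) :
    ∫ v in weylDomain b, F v = Nat.card P.weylGroup * ∫ v in alcove b, F v := by
  have := Fintype.ofFinite P.weylGroup
  have hcont := continuous_weyl_smul (P := P)
  rw [weylDomain, integral_iUnion_fintype
    (fun w ↦ ((isOpen_alcove b).preimage (hcont w)).measurableSet) ?_ ?_]
  · have h : ∀ w : P.weylGroup,
        ∫ v in (fun v ↦ w • v) ⁻¹' alcove b, F v = ∫ v in alcove b, F v := by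
      intro w
      rw [← (measurePreserving_weyl_smul w).setIntegral_preimage_emb
        (weylIsometry P w).toHomeomorph.measurableEmbedding F (alcove b)]
      simp only [hW]
    simp [h]
  · intro w w' hne
    refine Set.disjoint_left.mpr fun v hv hv' ↦ hne ?_
    have h : (0 : V) + (w' * w⁻¹) • (w • v) ∈ alcove b := by
      rw [zero_add, mul_smul, inv_smul_smul]; exact hv'
    exact (mul_inv_eq_one.mp (eq_of_add_smul_mem_alcove b hv (zero_mem _) h).2).symm
  · exact fun w ↦ integrableOn_of_continuous hF ((isBounded_weylDomain b).subset
      (Set.subset_iUnion (fun w : P.weylGroup ↦ (fun v ↦ w • v) ⁻¹' alcove b) w))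

/-- A translate of a fundamental domain is again one, and periodic functions have the same integral
over both. -/
theorem setIntegral_weylDomain_add {F : V → ℂ}
    (hL : ∀ q ∈ corootLattice P, ∀ v : V, F (q + v) = F v) (u : V) :
    ∫ v in weylDomain b, F (u + v) = ∫ v in weylDomain b, F v := by
  have hU := isAddFundamentalDomain_weylDomain b
  have h := hU.setIntegral_eq (hU.vadd_of_comm u) (f := F) fun g x ↦ hL g g.2 x
  rw [h, ← Set.image_vadd]
  exact ((measurePreserving_add_left volume u).setIntegral_image_emb
    (measurableEmbedding_addLeft u) F (weylDomain b)).symm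

/-- The integral of `h (t • u + v)` does not depend on `t`; differentiate under the integral at `t =
0`. This replaces the divergence theorem. -/
theorem setIntegral_weylDomain_fderiv {h : V → ℂ} (hh : ContDiff ℝ 1 h)
    (hL : ∀ q ∈ corootLattice P, ∀ v : V, h (q + v) = h v) (u : V) :
    ∫ v in weylDomain b, fderiv ℝ h v u = 0 := by
  obtain ⟨R, hR⟩ := (isBounded_weylDomain b).exists_norm_le
  have hcont : Continuous fun v ↦ fderiv ℝ h v u := by
    have := hh.continuous_fderiv one_ne_zero
    fun_prop
  -- The ball contains `t • u + v` for all `|t| ≤ 1` and `v` in the domain, so `C` dominates the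
  -- derivatives.
  obtain ⟨C, hC⟩ := (isCompact_closedBall (0 : V) (‖u‖ + R)).exists_bound_of_continuousOn
    hcont.continuousOn
  have hfin : IsFiniteMeasure ((volume : Measure V).restrict (weylDomain b)) :=
    isFiniteMeasure_restrict.mpr (isBounded_weylDomain b).measure_lt_top.ne
  have key := hasDerivAt_integral_of_dominated_loc_of_deriv_le
    (μ := (volume : Measure V).restrict (weylDomain b)) (F := fun (t : ℝ) v ↦ h (t • u + v))
    (F' := fun (t : ℝ) v ↦ fderiv ℝ h (t • u + v) u) (x₀ := 0) (s := Set.Icc (-1) 1)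
    (bound := fun _ ↦ C) (Icc_mem_nhds (by norm_num) (by norm_num)) ?_ ?_ ?_ ?_ ?_ ?_
  · have h1 := key.2
    have h2 : (fun t : ℝ ↦ ∫ v in weylDomain b, h (t • u + v)) =
        fun _ ↦ ∫ v in weylDomain b, h v := by
      funext t
      exact setIntegral_weylDomain_add b hL (t • u)
    rw [h2] at h1
    simpa using h1.unique (hasDerivAt_const _ _)
  · exact .of_forall fun t ↦
      (hh.continuous.comp (continuous_const.add continuous_id)).aestronglyMeasurable
  · exact integrableOn_of_continuous (hh.continuous.comp (continuous_const.add continuous_id))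
      (isBounded_weylDomain b)
  · exact (hcont.comp (continuous_const.add continuous_id)).aestronglyMeasurable
  · refine (ae_restrict_iff' (isOpen_weylDomain b).measurableSet).mpr
      (.of_forall fun v hv t ht ↦ hC _ ?_)
    rw [mem_closedBall_zero_iff]
    refine (norm_add_le _ _).trans (add_le_add ?_ (hR v hv))
    rw [norm_smul]
    exact mul_le_of_le_one_left (norm_nonneg _) (abs_le.mpr ht)
  · exact integrable_const _
  · refine .of_forall fun v t _ ↦ ?_
    have h1 : HasDerivAt (fun t : ℝ ↦ t • u + v) u t := by
      simpa using ((hasDerivAt_id t).smul_const u).add_const v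
    exact ((hh.differentiable one_ne_zero).differentiableAt.hasFDerivAt).comp_hasDerivAt t h1

end Domain

end WeylAlcove

/-! ### The Laplacian, isometries and exponentials -/

namespace WeylAlcove

open scoped ComplexConjugate

section Laplacian

variable {V : Type*} [NormedAddCommGroup V] [InnerProductSpace ℝ V] [FiniteDimensional ℝ V]

/-- The Laplacian may be computed in any orthonormal basis: use the standard one on the left and its
image under `e` on the right. -/
theorem laplacian_comp_isometry (F : V → ℂ) (e : V ≃ₗᵢ[ℝ] V) (v : V) :
    Δ (F ∘ e) v = Δ F (e v) := by
  rw [InnerProductSpace.laplacian_eq_iteratedFDeriv_orthonormalBasis (F ∘ e)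
      (stdOrthonormalBasis ℝ V),
    InnerProductSpace.laplacian_eq_iteratedFDeriv_orthonormalBasis F
      ((stdOrthonormalBasis ℝ V).map e)]
  refine Finset.sum_congr rfl fun i _ ↦ ?_
  have h := e.toContinuousLinearEquiv.iteratedFDerivWithin_comp_right F uniqueDiffOn_univ
    (Set.mem_univ (e v)) 2
  rw [Set.preimage_univ, iteratedFDerivWithin_univ, iteratedFDerivWithin_univ] at h
  change iteratedFDeriv ℝ 2 (F ∘ e.toContinuousLinearEquiv) v _ = _
  rw [h, ContinuousMultilinearMap.compContinuousLinearMap_apply]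
  congr 1
  ext j
  fin_cases j <;> simp

theorem laplacian_comp_add_left (F : V → ℂ) (q v : V) :
    Δ (fun x ↦ F (q + x)) v = Δ F (q + v) := by
  simp only [InnerProductSpace.laplacian_eq_iteratedFDeriv_stdOrthonormalBasis,
    iteratedFDeriv_comp_add_left]

theorem laplacian_eq_sum_fderiv {F : V → ℂ} (hF : ContDiff ℝ ∞ F) (v : V) :
    Δ F v = ∑ i, fderiv ℝ (fun x ↦ fderiv ℝ F x (stdOrthonormalBasis ℝ V i)) v
      (stdOrthonormalBasis ℝ V i) := by
  rw [InnerProductSpace.laplacian_eq_iteratedFDeriv_stdOrthonormalBasis]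
  refine Finset.sum_congr rfl fun i _ ↦ ?_
  rw [iteratedFDeriv_two_apply, fderiv_clm_apply]
  · simp
  · have h : ContDiff ℝ 1 (fderiv ℝ F) := hF.fderiv_right two_le_infty
    exact h.differentiable one_ne_zero v
  · exact differentiableAt_const _

/-- The exponential `v ↦ exp (i ⟨λ, v⟩)`. -/
def expWave (l : V) : smoothFunctions V :=
  ⟨fun v ↦ Complex.exp (Complex.I * (⟪l, v⟫_ℝ : ℂ)), by
    change ContDiff ℝ ∞ fun v ↦ Complex.exp (Complex.I * (⟪l, v⟫_ℝ : ℂ))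
    refine ContDiff.cexp (contDiff_const.mul (Complex.ofRealCLM.contDiff.comp ?_))
    exact contDiff_const.inner ℝ contDiff_id⟩

omit [FiniteDimensional ℝ V] in
theorem expWave_apply (l v : V) :
    (expWave l : V → ℂ) v = Complex.exp (Complex.I * (⟪l, v⟫_ℝ : ℂ)) := rfl

omit [FiniteDimensional ℝ V] in
theorem fderiv_expWave (l v : V) :
    fderiv ℝ (expWave l : V → ℂ) v =
      ((expWave l : V → ℂ) v * Complex.I) • (Complex.ofRealCLM ∘L innerSL ℝ l) := by
  have h : HasFDerivAt (fun v : V ↦ Complex.I * (⟪l, v⟫_ℝ : ℂ))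
      (Complex.I • (Complex.ofRealCLM ∘L innerSL ℝ l)) v :=
    ((Complex.ofRealCLM ∘L innerSL ℝ l).hasFDerivAt).const_mul Complex.I
  have h1 := h.cexp.fderiv
  rw [smul_smul] at h1
  exact h1

theorem laplacian_expWave (l : V) :
    laplacian V (expWave l) = (-(‖l‖ ^ 2 : ℝ) : ℂ) • expWave l := by
  ext v
  change Δ (expWave l : V → ℂ) v = (-(‖l‖ ^ 2 : ℝ) : ℂ) * (expWave l : V → ℂ) v
  rw [laplacian_eq_sum_fderiv (expWave l).2]
  have h : ∀ i, fderiv ℝ (fun x ↦ fderiv ℝ (expWave l : V → ℂ) x (stdOrthonormalBasis ℝ V i)) v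
      (stdOrthonormalBasis ℝ V i) =
      (-(⟪l, stdOrthonormalBasis ℝ V i⟫_ℝ * ⟪stdOrthonormalBasis ℝ V i, l⟫_ℝ : ℝ) : ℂ) *
        (expWave l : V → ℂ) v := by
    intro i
    have h1 : (fun x ↦ fderiv ℝ (expWave l : V → ℂ) x (stdOrthonormalBasis ℝ V i)) =
        fun x ↦ (expWave l : V → ℂ) x * (Complex.I * (⟪l, stdOrthonormalBasis ℝ V i⟫_ℝ : ℂ)) := by
      funext x
      rw [fderiv_expWave]
      simp [mul_assoc]
    have hd : ContDiff ℝ ∞ (expWave l : V → ℂ) := (expWave l).2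
    rw [h1, fderiv_mul_const (hd.differentiable (by simp) v), fderiv_expWave,
      real_inner_comm l]
    simp only [FunLike.coe_smul, Pi.smul_apply, ContinuousLinearMap.comp_apply, smul_eq_mul,
      innerSL_apply_apply, Complex.ofRealCLM_apply]
    push_cast
    linear_combination (⟪l, stdOrthonormalBasis ℝ V i⟫_ℝ : ℂ) ^ 2 * (expWave l : V → ℂ) v *
      Complex.I_sq
  simp_rw [h]
  rw [← Finset.sum_mul, Finset.sum_neg_distrib, ← Complex.ofReal_sum,
    OrthonormalBasis.sum_inner_mul_inner, real_inner_self_eq_norm_sq]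

end Laplacian

/-! ### Green's identity, symmetry and positivity -/

section Pairing

variable {ι V : Type*} [NormedAddCommGroup V] [InnerProductSpace ℝ V]
  {P : RootPairing ι ℝ V V} (b : P.Base) [IsEuclidean P]
  [Finite ι] [FiniteDimensional ℝ V] [P.IsRootSystem]

omit [Finite ι] [P.IsRootSystem] in
theorem laplacian_mem_invariantSmoothFunctions {F : smoothFunctions V}
    (hF : F ∈ invariantSmoothFunctions P) : laplacian V F ∈ invariantSmoothFunctions P := by
  rw [mem_invariantSmoothFunctions_iff] at hF ⊢
  constructor
  · intro w v
    have h := laplacian_comp_isometry (F : V → ℂ) (weylIsometry P w) v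
    rw [show (F : V → ℂ) ∘ weylIsometry P w = F from funext fun v ↦ hF.1 w v] at h
    exact h.symm
  · intro q hq v
    have h := laplacian_comp_add_left (F : V → ℂ) q v
    rw [show (fun x ↦ (F : V → ℂ) (q + x)) = F from funext fun v ↦ hF.2 q hq v] at h
    exact h.symm

variable [MeasurableSpace V] [BorelSpace V]

omit [IsEuclidean P] in
theorem inner_restrict (F G : smoothFunctions V) :
    ⟪restrict b F, restrict b G⟫_ℂ =
      ∫ v in alcove b, conj ((F : V → ℂ) v) * (G : V → ℂ) v := by
  rw [L2.inner_def]
  refine integral_congr_ae ?_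
  filter_upwards [(memLp_of_smooth b F).coeFn_toLp, (memLp_of_smooth b G).coeFn_toLp] with v hF hG
  change ⟪(memLp_of_smooth b F).toLp _ v, (memLp_of_smooth b G).toLp _ v⟫_ℂ = _
  rw [hF, hG, RCLike.inner_apply, mul_comm]

variable [P.IsCrystallographic] [P.IsReduced]

theorem card_mul_inner_restrict {F G : smoothFunctions V} (hF : F ∈ invariantSmoothFunctions P)
    (hG : G ∈ invariantSmoothFunctions P) :
    Nat.card P.weylGroup * ⟪restrict b F, restrict b G⟫_ℂ =
      ∫ v in weylDomain b, conj ((F : V → ℂ) v) * (G : V → ℂ) v := by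
  have hF' : ContDiff ℝ ∞ (F : V → ℂ) := F.2
  have hG' : ContDiff ℝ ∞ (G : V → ℂ) := G.2
  rw [inner_restrict, ← setIntegral_weylDomain b (F := fun v ↦ conj ((F : V → ℂ) v) * (G : V → ℂ) v)
    ((Complex.continuous_conj.comp hF'.continuous).mul hG'.continuous)]
  intro w v
  rw [(mem_invariantSmoothFunctions_iff.mp hF).1, (mem_invariantSmoothFunctions_iff.mp hG).1]

theorem setIntegral_fderiv_mul {F G : V → ℂ} (hF : ContDiff ℝ ∞ F) (hG : ContDiff ℝ ∞ G)
    (hFL : ∀ q ∈ corootLattice P, ∀ v : V, F (q + v) = F v)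
    (hGL : ∀ q ∈ corootLattice P, ∀ v : V, G (q + v) = G v) (u : V) :
    ∫ v in weylDomain b, conj (fderiv ℝ F v u) * G v =
      -∫ v in weylDomain b, conj (F v) * fderiv ℝ G v u := by
  have hFd := hF.differentiable (by simp)
  have hGd := hG.differentiable (by simp)
  have hc : ContDiff ℝ ∞ fun v ↦ conj (F v) := Complex.conjCLE.contDiff.comp hF
  have h := setIntegral_weylDomain_fderiv b (h := fun v ↦ conj (F v) * G v)
    ((hc.mul hG).of_le (by exact_mod_cast le_top))
    (fun q hq v ↦ by rw [hFL q hq, hGL q hq]) u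
  have h1 : ∀ v, fderiv ℝ (fun v ↦ conj (F v) * G v) v u =
      conj (F v) * fderiv ℝ G v u + conj (fderiv ℝ F v u) * G v := by
    intro v
    have h2 : HasFDerivAt (fun v ↦ conj (F v))
        ((Complex.conjCLE : ℂ →L[ℝ] ℂ) ∘L fderiv ℝ F v) v :=
      (Complex.conjCLE : ℂ →L[ℝ] ℂ).hasFDerivAt.comp v (hFd v).hasFDerivAt
    have h3 : HasFDerivAt (fun v ↦ conj (F v) * G v) _ v := h2.mul (hGd v).hasFDerivAt
    rw [h3.fderiv]
    simp [mul_comm]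
  simp_rw [h1] at h
  have hF1 : Continuous fun v ↦ fderiv ℝ F v u := by
    have := hF.continuous_fderiv (by simp)
    fun_prop
  have hG1 : Continuous fun v ↦ fderiv ℝ G v u := by
    have := hG.continuous_fderiv (by simp)
    fun_prop
  rw [integral_add (f := fun v ↦ conj (F v) * fderiv ℝ G v u)
    (g := fun v ↦ conj (fderiv ℝ F v u) * G v)
    (integrableOn_of_continuous ((Complex.continuous_conj.comp hF.continuous).mul hG1)
      (isBounded_weylDomain b))
    (integrableOn_of_continuous ((Complex.continuous_conj.comp hF1).mul hG.continuous)
      (isBounded_weylDomain b))] at h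
  exact eq_neg_of_add_eq_zero_right h

/-- Green's identity on the alcove. -/
theorem card_mul_inner_laplacian_left {F G : smoothFunctions V}
    (hF : F ∈ invariantSmoothFunctions P) (hG : G ∈ invariantSmoothFunctions P) :
    Nat.card P.weylGroup * ⟪-restrict b (laplacian V F), restrict b G⟫_ℂ =
      ∑ i, ∫ v in weylDomain b, conj (fderiv ℝ (F : V → ℂ) v (stdOrthonormalBasis ℝ V i)) *
        fderiv ℝ (G : V → ℂ) v (stdOrthonormalBasis ℝ V i) := by
  have hF' : ContDiff ℝ ∞ (F : V → ℂ) := F.2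
  have hG' : ContDiff ℝ ∞ (G : V → ℂ) := G.2
  have hFL := (mem_invariantSmoothFunctions_iff.mp hF).2
  have hGL := (mem_invariantSmoothFunctions_iff.mp hG).2
  have hd : ∀ u, ContDiff ℝ ∞ fun v ↦ fderiv ℝ (F : V → ℂ) v u := fun u ↦
    (hF'.fderiv_right (m := ∞) (by exact le_refl _)).clm_apply contDiff_const
  have hdL : ∀ u, ∀ q ∈ corootLattice P, ∀ v : V,
      fderiv ℝ (F : V → ℂ) (q + v) u = fderiv ℝ (F : V → ℂ) v u := by
    intro u q hq v
    rw [← fderiv_comp_add_left, funext (hFL q hq)]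
  rw [inner_neg_left, mul_neg,
    card_mul_inner_restrict b (laplacian_mem_invariantSmoothFunctions hF) hG]
  have h1 : ∀ v, conj ((laplacian V F : V → ℂ) v) * (G : V → ℂ) v =
      ∑ i, conj (fderiv ℝ (fun x ↦ fderiv ℝ (F : V → ℂ) x (stdOrthonormalBasis ℝ V i)) v
        (stdOrthonormalBasis ℝ V i)) * (G : V → ℂ) v := by
    intro v
    change conj (Δ (F : V → ℂ) v) * _ = _
    rw [laplacian_eq_sum_fderiv hF', map_sum, Finset.sum_mul]
  simp_rw [h1]
  rw [integral_finsetSum, ← Finset.sum_neg_distrib]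
  · refine Finset.sum_congr rfl fun i _ ↦ ?_
    rw [setIntegral_fderiv_mul b (hd _) hG' (hdL _) hGL, neg_neg]
  · intro i _
    have hc : Continuous fun v ↦ fderiv ℝ (fun x ↦ fderiv ℝ (F : V → ℂ) x
        (stdOrthonormalBasis ℝ V i)) v (stdOrthonormalBasis ℝ V i) := by
      have := (hd (stdOrthonormalBasis ℝ V i)).continuous_fderiv (by simp)
      fun_prop
    exact integrableOn_of_continuous ((Complex.continuous_conj.comp hc).mul hG'.continuous)
      (isBounded_weylDomain b)

omit [IsEuclidean P] [FiniteDimensional ℝ V] [MeasurableSpace V] [BorelSpace V]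
  [P.IsCrystallographic] [P.IsReduced] in
theorem card_weylGroup_ne_zero : (Nat.card P.weylGroup : ℂ) ≠ 0 :=
  Nat.cast_ne_zero.mpr Nat.card_pos.ne'

/-- By Green's identity both sides are the same Hermitian Dirichlet form, up to the factor `#W`. -/
theorem inner_laplacian_left_eq {F G : smoothFunctions V}
    (hF : F ∈ invariantSmoothFunctions P) (hG : G ∈ invariantSmoothFunctions P) :
    ⟪-restrict b (laplacian V F), restrict b G⟫_ℂ =
      ⟪restrict b F, -restrict b (laplacian V G)⟫_ℂ := by
  refine mul_left_cancel₀ (card_weylGroup_ne_zero (P := P)) ?_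
  rw [card_mul_inner_laplacian_left b hF hG, ← inner_conj_symm (restrict b F),
    ← Complex.conj_natCast, ← map_mul, card_mul_inner_laplacian_left b hG hF, map_sum]
  refine Finset.sum_congr rfl fun i _ ↦ ?_
  rw [← integral_conj]
  simp only [map_mul, Complex.conj_conj, mul_comm]

theorem re_inner_laplacian_nonneg {F : smoothFunctions V}
    (hF : F ∈ invariantSmoothFunctions P) :
    0 ≤ (⟪restrict b F, -restrict b (laplacian V F)⟫_ℂ).re := by
  have h := card_mul_inner_laplacian_left b hF hF
  rw [inner_laplacian_left_eq b hF hF] at h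
  have h1 : ∀ i, ∫ v in weylDomain b,
      conj (fderiv ℝ (F : V → ℂ) v (stdOrthonormalBasis ℝ V i)) *
        fderiv ℝ (F : V → ℂ) v (stdOrthonormalBasis ℝ V i) =
      ((∫ v in weylDomain b, ‖fderiv ℝ (F : V → ℂ) v (stdOrthonormalBasis ℝ V i)‖ ^ 2 : ℝ) : ℂ) := by
    intro i
    rw [← integral_complex_ofReal]
    refine integral_congr_ae (.of_forall fun v ↦ ?_)
    simp [Complex.conj_mul']
  simp_rw [h1] at h
  have h2 := congrArg Complex.re h
  rw [← Complex.ofReal_natCast, Complex.re_ofReal_mul, ← Complex.ofReal_sum,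
    Complex.ofReal_re] at h2
  have h3 : (0 : ℝ) < Nat.card P.weylGroup := by exact_mod_cast Nat.card_pos
  refine nonneg_of_mul_nonneg_right ?_ h3
  rw [h2]
  exact Finset.sum_nonneg fun i _ ↦ integral_nonneg fun v ↦ by positivity

end Pairing

end WeylAlcove

/-! ### Weights and plane waves: eigenfunctions, nonvanishing, orthogonality -/

namespace WeylAlcove

open scoped ComplexConjugate

section PlaneWave

variable {ι V : Type*} [NormedAddCommGroup V] [InnerProductSpace ℝ V]

/-- The weight lattice. -/
def IsWeight (P : RootPairing ι ℝ V V) (l : V) : Prop :=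
  ∀ i, ∃ n : ℤ, ⟪l, P.coroot i⟫_ℝ = n

variable {P : RootPairing ι ℝ V V}

theorem isWeight_of_mem_dominantWeights {b : P.Base} {μ : V} (hμ : μ ∈ dominantWeights b) :
    IsWeight P μ := by
  intro i
  let := P.indexNeg
  rcases RootPairing.Base.IsPos.or_neg b i with hi | hi
  · obtain ⟨n, hn⟩ := hμ i hi
    exact ⟨n, by simpa using hn⟩
  · obtain ⟨n, hn⟩ := hμ _ hi
    have h : P.coroot (-i) = -P.coroot i := by
      change P.coroot (P.reflectionPerm i i) = _
      rw [P.coroot_reflectionPerm, P.coreflection_apply_self]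
    rw [h, inner_neg_right] at hn
    exact ⟨-n, by push_cast; linarith⟩

theorem IsWeight.exists_int {l q : V} (hl : IsWeight P l) (hq : q ∈ corootLattice P) :
    ∃ n : ℤ, ⟪l, q⟫_ℝ = n := by
  induction hq using AddSubgroup.closure_induction with
  | mem x hx => obtain ⟨j, rfl⟩ := hx; exact hl j
  | zero => exact ⟨0, by simp⟩
  | add x y _ _ hx hy =>
    obtain ⟨n, hn⟩ := hx
    obtain ⟨m, hm⟩ := hy
    exact ⟨n + m, by simp [inner_add_right, hn, hm]⟩
  | neg x _ hx =>
    obtain ⟨n, hn⟩ := hx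
    exact ⟨-n, by simp [hn]⟩

theorem IsWeight.sub {l m : V} (hl : IsWeight P l) (hm : IsWeight P m) : IsWeight P (l - m) := by
  intro i
  obtain ⟨n, hn⟩ := hl i
  obtain ⟨k, hk⟩ := hm i
  exact ⟨n - k, by rw [inner_sub_left, hn, hk]; push_cast; rfl⟩

theorem continuous_expWave (l : V) : Continuous (expWave l : V → ℂ) := by
  have h : ContDiff ℝ ∞ (expWave l : V → ℂ) := (expWave l).2
  exact h.continuous

theorem expWave_add_of_isWeight {l q : V} (hl : IsWeight P l) (hq : q ∈ corootLattice P) (v : V) :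
    (expWave ((2 * Real.pi) • l) : V → ℂ) (q + v) = (expWave ((2 * Real.pi) • l) : V → ℂ) v := by
  obtain ⟨n, hn⟩ := hl.exists_int hq
  rw [expWave_apply, expWave_apply, inner_add_right, inner_smul_left, hn,
    Complex.exp_eq_exp_iff_exists_int]
  refine ⟨n, ?_⟩
  simp only [conj_trivial]
  push_cast
  ring

variable [IsEuclidean P]

theorem IsWeight.weyl_smul {l : V} (hl : IsWeight P l) (w : P.weylGroup) : IsWeight P (w • l) := by
  intro i
  rw [inner_weyl_smul_left, ← coroot_idx]
  exact hl _

theorem expWave_weyl_smul (w : P.weylGroup) (l v : V) :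
    (expWave l : V → ℂ) (w • v) = (expWave (w⁻¹ • l) : V → ℂ) v := by
  rw [expWave_apply, expWave_apply, inner_weyl_smul_left, inv_inv]

variable [Finite ι] [P.IsRootSystem]

variable (P) in
/-- The plane wave as a smooth function. -/
def planeWaveSmooth (μ : V) : smoothFunctions V := ⟨planeWave P μ, contDiff_planeWave μ⟩

omit [IsEuclidean P] in
theorem planeWaveSmooth_eq_sum [Fintype P.weylGroup] (μ : V) :
    planeWaveSmooth P μ =
      (Nat.card P.weylGroup : ℂ)⁻¹ • ∑ w : P.weylGroup, expWave (w • μ) := by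
  ext v
  change planeWave P μ v = (Nat.card P.weylGroup : ℂ)⁻¹ *
    ((∑ w : P.weylGroup, expWave (w • μ) : smoothFunctions V) : V → ℂ) v
  rw [planeWave, finsum_eq_sum_of_fintype, Submodule.coe_sum, Finset.sum_apply]
  rfl

omit [IsEuclidean P] in
theorem planeWaveSmooth_apply [Fintype P.weylGroup] (μ v : V) :
    (planeWaveSmooth P μ : V → ℂ) v =
      (Nat.card P.weylGroup : ℂ)⁻¹ * ∑ w : P.weylGroup, (expWave (w • μ) : V → ℂ) v := by
  change planeWave P μ v = _
  rw [planeWave, finsum_eq_sum_of_fintype]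
  rfl

omit [IsEuclidean P] in
theorem planeWaveSmooth_weyl_smul (w : P.weylGroup) (μ : V) :
    planeWaveSmooth P (w • μ) = planeWaveSmooth P μ := by
  have := Fintype.ofFinite P.weylGroup
  rw [planeWaveSmooth_eq_sum, planeWaveSmooth_eq_sum]
  congr 1
  simp only [← mul_smul]
  exact _root_.Equiv.sum_comp (Equiv.mulRight w) fun w ↦ expWave (w • μ)

theorem planeWaveSmooth_mem {l : V} (hl : IsWeight P l) :
    planeWaveSmooth P ((2 * Real.pi) • l) ∈ invariantSmoothFunctions P := by
  have := Fintype.ofFinite P.weylGroup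
  refine mem_invariantSmoothFunctions_iff.mpr ⟨fun w v ↦ ?_, fun q hq v ↦ ?_⟩
  · rw [planeWaveSmooth_apply, planeWaveSmooth_apply]
    simp only [expWave_weyl_smul, ← mul_smul]
    congr 1
    exact _root_.Equiv.sum_comp (Equiv.mulLeft w⁻¹)
      fun w : P.weylGroup ↦ (expWave (w • (2 * Real.pi) • l) : V → ℂ) v
  · rw [planeWaveSmooth_apply, planeWaveSmooth_apply]
    simp only [weyl_smul_smul, expWave_add_of_isWeight (hl.weyl_smul _) hq]

variable [FiniteDimensional ℝ V]

theorem laplacian_planeWaveSmooth (μ : V) :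
    laplacian V (planeWaveSmooth P μ) = (-(‖μ‖ ^ 2 : ℝ) : ℂ) • planeWaveSmooth P μ := by
  have := Fintype.ofFinite P.weylGroup
  rw [planeWaveSmooth_eq_sum, map_smul, map_sum]
  simp only [laplacian_expWave, norm_weyl_smul]
  rw [← Finset.smul_sum, smul_comm]

omit [IsEuclidean P] [FiniteDimensional ℝ V] in
theorem finite_dominantWeights_norm_le (b : P.Base) (C : ℝ) :
    {μ | μ ∈ dominantWeights b ∧ ‖μ‖ ≤ C}.Finite := by
  refine (finite_norm_le_of_inner_int P.coroot
    RootPairing.IsRootSystem.span_coroot_eq_top C).subset fun μ hμ ↦ ⟨hμ.2, fun i ↦ ?_⟩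
  rw [real_inner_comm]
  exact isWeight_of_mem_dominantWeights hμ.1 i

omit [Finite ι] [P.IsRootSystem] [FiniteDimensional ℝ V] in
theorem inner_root_nonneg_of_mem_dominantWeights {b : P.Base} {μ : V}
    (hμ : μ ∈ dominantWeights b) (i : ι) (hi : b.IsPos i) : 0 ≤ ⟪P.root i, μ⟫_ℝ := by
  obtain ⟨n, hn⟩ := hμ i hi
  rw [real_inner_comm, inner_coroot_left] at hn
  refine nonneg_of_mul_nonneg_right ?_ (coroot_factor_pos P i)
  rw [hn]
  exact n.cast_nonneg

variable [P.IsCrystallographic]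

/-- Choose `w` maximising `⟪w • l, a⟫` for a point `a` of the alcove: a negative pairing with a
positive root could be reflected to increase it. -/
theorem exists_weyl_smul_mem_dominantWeights (b : P.Base) {l : V} (hl : IsWeight P l) :
    ∃ w : P.weylGroup, w • l ∈ dominantWeights b := by
  obtain ⟨a, ha⟩ := exists_mem_alcove b
  obtain ⟨w, hw⟩ := Finite.exists_max fun w : P.weylGroup ↦ ⟪w • l, a⟫_ℝ
  refine ⟨w, fun i hi ↦ ?_⟩
  have h1 := hw (RootPairing.weylGroup.ofIdx P i * w)
  rw [mul_smul, ofIdx_smul, inner_sub_left, inner_smul_left, inner_coroot_left] at h1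
  have h2 := (ha i hi).1
  have h3 := coroot_factor_pos P i
  simp only [conj_trivial] at h1
  have h4 : 0 ≤ ⟪P.root i, w • l⟫_ℝ := by
    by_contra! h
    nlinarith [mul_pos h3 h2]
  obtain ⟨n, hn⟩ := hl.weyl_smul w i
  have h5 : (0 : ℝ) ≤ n := by
    rw [← hn, real_inner_comm, inner_coroot_left]
    positivity
  lift n to ℕ using (by exact_mod_cast h5)
  exact ⟨n, by simpa using hn⟩

variable [P.IsReduced] [MeasurableSpace V] [BorelSpace V]

theorem setIntegral_expWave_eq_zero (b : P.Base) {l : V} (hl : IsWeight P l) (h0 : l ≠ 0) :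
    ∫ v in weylDomain b, (expWave ((2 * Real.pi) • l) : V → ℂ) v = 0 := by
  -- This shift changes the phase by exactly `π`, so the integral equals its own negative.
  have h := setIntegral_weylDomain_add b (F := (expWave ((2 * Real.pi) • l) : V → ℂ))
    (fun q hq v ↦ expWave_add_of_isWeight hl hq v) ((2 * ‖l‖ ^ 2)⁻¹ • l)
  have h1 : ∀ v, (expWave ((2 * Real.pi) • l) : V → ℂ) ((2 * ‖l‖ ^ 2)⁻¹ • l + v) =
      -(expWave ((2 * Real.pi) • l) : V → ℂ) v := by
    intro v
    have h2 : ⟪(2 * Real.pi) • l, (2 * ‖l‖ ^ 2)⁻¹ • l⟫_ℝ = Real.pi := by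
      rw [inner_smul_left, inner_smul_right, real_inner_self_eq_norm_sq]
      have := norm_ne_zero_iff.mpr h0
      simp only [conj_trivial]
      field_simp
    rw [expWave_apply, expWave_apply, inner_add_right, h2, Complex.ofReal_add, mul_add,
      Complex.exp_add, mul_comm Complex.I, Complex.exp_pi_mul_I, neg_one_mul]
  simp_rw [h1] at h
  rw [integral_neg] at h
  exact self_eq_neg.mp h.symm

omit [IsEuclidean P] [P.IsReduced] in
theorem planeWaveL2_ne_zero (b : P.Base) (μ : V) : planeWaveL2 b μ ≠ 0 := by
  have := Fintype.ofFinite P.weylGroup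
  intro h
  have hF : ContDiff ℝ ∞ (planeWave P μ) := contDiff_planeWave μ
  have h0 : planeWave P μ =ᵐ[(volume : Measure V).restrict (alcove b)] 0 :=
    (MemLp.coeFn_toLp (memLp_of_smooth b (planeWaveSmooth P μ))).symm.trans
      ((by rw [show (memLp_of_smooth b (planeWaveSmooth P μ)).toLp _ = 0 from h]
           exact Lp.coeFn_zero _ _ _))
  have h1 : Set.EqOn (planeWave P μ) 0 (alcove b) :=
    Measure.eqOn_open_of_ae_eq h0 (isOpen_alcove b) hF.continuous.continuousOn continuousOn_const
  -- The origin is in the closure of the alcove, and every plane wave takes the value 1 there.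
  have h2 := h1.closure hF.continuous continuous_const (zero_mem_closure_alcove b)
  have h3 : (planeWaveSmooth P μ : V → ℂ) 0 = 1 := by
    rw [planeWaveSmooth_apply]
    simp only [expWave_apply, inner_zero_right, Complex.ofReal_zero, mul_zero, Complex.exp_zero,
      Finset.sum_const, Finset.card_univ, nsmul_eq_mul, mul_one, Nat.card_eq_fintype_card]
    refine inv_mul_cancel₀ ?_
    rw [← Nat.card_eq_fintype_card]
    exact card_weylGroup_ne_zero
  exact one_ne_zero (h3.symm.trans h2)

/-- The product expands into exponentials with frequencies `w' • ν - w • μ`. A zero frequency would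
put `μ` and `ν` in one Weyl orbit, where dominant vectors are unique. -/
theorem inner_planeWaveL2_eq_zero (b : P.Base) {μ ν : V} (hμ : μ ∈ dominantWeights b)
    (hν : ν ∈ dominantWeights b) (hne : μ ≠ ν) :
    ⟪planeWaveL2 b ((2 * Real.pi) • μ), planeWaveL2 b ((2 * Real.pi) • ν)⟫_ℂ = 0 := by
  have := Fintype.ofFinite P.weylGroup
  have hμ' := isWeight_of_mem_dominantWeights hμ
  have hν' := isWeight_of_mem_dominantWeights hν
  refine (mul_eq_zero.mp ((card_mul_inner_restrict b (planeWaveSmooth_mem hμ')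
    (planeWaveSmooth_mem hν')).trans ?_)).resolve_left card_weylGroup_ne_zero
  have h1 : ∀ v, conj ((planeWaveSmooth P ((2 * Real.pi) • μ) : V → ℂ) v) *
      (planeWaveSmooth P ((2 * Real.pi) • ν) : V → ℂ) v =
      (Nat.card P.weylGroup : ℂ)⁻¹ * (Nat.card P.weylGroup : ℂ)⁻¹ *
        ∑ w : P.weylGroup, ∑ w' : P.weylGroup,
          (expWave ((2 * Real.pi) • (w' • ν - w • μ)) : V → ℂ) v := by
    intro v
    rw [planeWaveSmooth_apply, planeWaveSmooth_apply, map_mul, map_inv₀, Complex.conj_natCast,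
      map_sum, mul_mul_mul_comm, Finset.sum_mul_sum]
    congr 1
    refine Finset.sum_congr rfl fun w _ ↦ Finset.sum_congr rfl fun w' _ ↦ ?_
    rw [expWave_apply, expWave_apply, expWave_apply, ← Complex.exp_conj, ← Complex.exp_add]
    congr 1
    rw [map_mul, Complex.conj_I, Complex.conj_ofReal, weyl_smul_smul, weyl_smul_smul, smul_sub,
      inner_sub_left]
    push_cast
    ring
  have hint : ∀ l : V, IntegrableOn (expWave l : V → ℂ) (weylDomain b) := fun l ↦
    integrableOn_of_continuous (continuous_expWave l) (isBounded_weylDomain b)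
  simp_rw [h1]
  rw [integral_const_mul, integral_finsetSum _ fun w _ ↦ integrable_finsetSum _ fun w' _ ↦ hint _]
  refine mul_eq_zero_of_right _ (Finset.sum_eq_zero fun w _ ↦ ?_)
  rw [integral_finsetSum _ fun w' _ ↦ hint _]
  refine Finset.sum_eq_zero fun w' _ ↦
    setIntegral_expWave_eq_zero b ((hν'.weyl_smul w').sub (hμ'.weyl_smul w)) fun h ↦ hne ?_
  have h2 : (w'⁻¹ * w) • μ = ν := by rw [mul_smul, ← sub_eq_zero.mp h, inv_smul_smul]
  have h3 := weyl_smul_eq_of_dominant b (w'⁻¹ * w) μ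
    (inner_root_nonneg_of_mem_dominantWeights hμ)
    (h2 ▸ inner_root_nonneg_of_mem_dominantWeights hν)
  exact h3.symm.trans h2

end PlaneWave

end WeylAlcove

/-! ### Uniform approximation of invariant functions by plane waves -/

namespace WeylAlcove

open scoped ComplexConjugate

section Approximation

variable {ι V : Type*} [Finite ι] [NormedAddCommGroup V] [InnerProductSpace ℝ V]
  [FiniteDimensional ℝ V] {P : RootPairing ι ℝ V V} [P.IsRootSystem]

/-- The projection of `V` to the torus with the simple coroots as basis. -/
def torusProj (b : P.Base) (v : V) : UnitAddTorus b.support :=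
  fun i ↦ ((b.toCoweightBasis.equivFun v i : ℝ) : UnitAddCircle)

omit [FiniteDimensional ℝ V] in
theorem isOpenQuotientMap_torusProj (b : P.Base) : IsOpenQuotientMap (torusProj b) := by
  have h1 : IsOpenQuotientMap (Pi.map fun (_ : b.support) (x : ℝ) ↦ (x : UnitAddCircle)) :=
    IsOpenQuotientMap.piMap fun _ ↦ QuotientAddGroup.isOpenQuotientMap_mk
  exact h1.comp b.toCoweightBasis.equivFunL.toHomeomorph.isOpenQuotientMap

omit [FiniteDimensional ℝ V] in
theorem sub_mem_corootLattice_of_torusProj_eq (b : P.Base) {u v : V}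
    (h : torusProj b u = torusProj b v) : u - v ∈ corootLattice P := by
  have h1 : ∀ i, ∃ n : ℤ, b.toCoweightBasis.equivFun (u - v) i = n := by
    intro i
    obtain ⟨n, hn⟩ := AddSubgroup.mem_zmultiples_iff.mp (QuotientAddGroup.eq.mp (congrFun h i))
    rw [zsmul_one] at hn
    refine ⟨-n, ?_⟩
    rw [map_sub, Pi.sub_apply]
    push_cast
    linarith
  rw [← b.toCoweightBasis.sum_equivFun (u - v)]
  refine sum_mem fun i _ ↦ ?_
  obtain ⟨n, hn⟩ := h1 i
  rw [hn, Int.cast_smul_eq_zsmul, RootPairing.Base.toCoweightBasis_apply]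
  exact zsmul_mem (coroot_mem_corootLattice P i) n

variable (P) in
/-- The trigonometric polynomials with frequencies in the weight lattice. -/
def trigPolys : Submodule ℂ (smoothFunctions V) :=
  Submodule.span ℂ ((fun l ↦ expWave ((2 * Real.pi) • l)) '' {l | IsWeight P l})

/-- The functional dual to `l` takes the values `n i` on the simple coroots. As these span all
coroots over `ℤ`, `l` is a weight. -/
theorem exists_expWave_eq_mFourier (b : P.Base) (n : b.support → ℤ) :
    ∃ l, IsWeight P l ∧ ∀ v : V,
      (expWave ((2 * Real.pi) • l) : V → ℂ) v = UnitAddTorus.mFourier n (torusProj b v) := by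
  let f : V →ₗ[ℝ] ℝ := b.toCoweightBasis.constr ℝ fun i ↦ (n i : ℝ)
  let l : V := (InnerProductSpace.toDual ℝ V).symm f.toContinuousLinearMap
  have hl : ∀ v, ⟪l, v⟫_ℝ = f v := fun v ↦ InnerProductSpace.toDual_symm_apply
  refine ⟨l, fun i ↦ ?_, fun v ↦ ?_⟩
  · have h : ∀ x ∈ Submodule.span ℤ (P.coroot '' b.support), ∃ n : ℤ, ⟪l, x⟫_ℝ = n := ?_
    · exact h _ (b.coroot_mem_span_int i)
    intro x hx
    induction hx using Submodule.span_induction with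
    | mem x hx =>
      obtain ⟨j, hj, rfl⟩ := hx
      refine ⟨n ⟨j, hj⟩, ?_⟩
      rw [hl, show P.coroot j = b.toCoweightBasis ⟨j, hj⟩ by simp, Module.Basis.constr_basis]
    | zero => exact ⟨0, by simp⟩
    | add x y _ _ hx hy =>
      obtain ⟨n, hn⟩ := hx
      obtain ⟨m, hm⟩ := hy
      exact ⟨n + m, by simp [inner_add_right, hn, hm]⟩
    | smul c x _ hx =>
      obtain ⟨n, hn⟩ := hx
      refine ⟨c * n, ?_⟩
      rw [← Int.cast_smul_eq_zsmul ℝ c, inner_smul_right, hn]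
      push_cast
      rfl
  · have h : f v = ∑ i, b.toCoweightBasis.equivFun v i * n i := by
      rw [Module.Basis.constr_apply_fintype]
      rfl
    rw [expWave_apply, inner_smul_left, hl, h]
    change _ = ∏ i, fourier (n i) ((b.toCoweightBasis.equivFun v i : ℝ) : UnitAddCircle)
    simp_rw [fourier_coe_apply]
    rw [← Complex.exp_sum]
    congr 1
    simp only [conj_trivial]
    push_cast
    rw [Finset.mul_sum, Finset.mul_sum]
    refine Finset.sum_congr rfl fun i _ ↦ ?_
    simp only [div_one]
    ring

/-- Continuous functions that are periodic with respect to the coroot lattice are uniform limits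
of trigonometric polynomials. -/
theorem exists_trigPoly_close (b : P.Base) {G : V → ℂ} (hG : Continuous G)
    (hL : ∀ q ∈ corootLattice P, ∀ v : V, G (q + v) = G v) {ε : ℝ} (hε : 0 < ε) :
    ∃ p ∈ trigPolys P, ∀ v, ‖G v - (p : V → ℂ) v‖ ≤ ε := by
  have hq := isOpenQuotientMap_torusProj b
  let π : C(V, UnitAddTorus b.support) := ⟨torusProj b, hq.continuous⟩
  have hπ : Topology.IsQuotientMap π := hq.isQuotientMap
  -- Periodicity lets `G` descend to the torus, where the Fourier monomials have dense span.
  have hfac : Function.FactorsThrough (⟨G, hG⟩ : C(V, ℂ)) π := fun u v h ↦ by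
    have := hL _ (sub_mem_corootLattice_of_torusProj_eq b h) v
    rw [sub_add_cancel] at this
    exact this
  let g : C(UnitAddTorus b.support, ℂ) := hπ.lift ⟨G, hG⟩ hfac
  have hg : ∀ v, g (torusProj b v) = G v := fun v ↦ congrArg (fun f : C(V, ℂ) ↦ f v)
    (hπ.lift_comp ⟨G, hG⟩ hfac)
  have hmem : g ∈ (Submodule.span ℂ
      (Set.range (UnitAddTorus.mFourier (d := b.support)))).topologicalClosure := by
    rw [UnitAddTorus.span_mFourier_closure_eq_top]
    trivial
  obtain ⟨t, ht, hdist⟩ := Metric.mem_closure_iff.mp hmem ε hε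
  have hpull : ∀ t ∈ Submodule.span ℂ (Set.range (UnitAddTorus.mFourier (d := b.support))),
      ∃ p ∈ trigPolys P, ∀ v, (p : V → ℂ) v = t (torusProj b v) := by
    intro t ht
    induction ht using Submodule.span_induction with
    | mem x hx =>
      obtain ⟨n, rfl⟩ := hx
      obtain ⟨l, hl, h⟩ := exists_expWave_eq_mFourier b n
      exact ⟨_, Submodule.subset_span ⟨l, hl, rfl⟩, h⟩
    | zero => exact ⟨0, zero_mem _, fun v ↦ rfl⟩
    | add x y _ _ hx hy =>
      obtain ⟨p, hp, hp'⟩ := hx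
      obtain ⟨r, hr, hr'⟩ := hy
      exact ⟨p + r, add_mem hp hr, fun v ↦ congrArg₂ (· + ·) (hp' v) (hr' v)⟩
    | smul c x _ hx =>
      obtain ⟨p, hp, hp'⟩ := hx
      exact ⟨c • p, Submodule.smul_mem _ c hp, fun v ↦ congrArg (c * ·) (hp' v)⟩
  obtain ⟨p, hp, hpt⟩ := hpull t ht
  refine ⟨p, hp, fun v ↦ ?_⟩
  rw [hpt, ← hg, ← dist_eq_norm]
  exact (ContinuousMap.dist_apply_le_dist _).trans hdist.le

variable [IsEuclidean P] [P.IsCrystallographic]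

/-- The span of the plane waves with dominant weights. -/
def planeWaveSpan (b : P.Base) : Submodule ℂ (smoothFunctions V) :=
  Submodule.span ℂ ((fun μ ↦ planeWaveSmooth P ((2 * Real.pi) • μ)) '' dominantWeights b)

/-- Averaging one exponential over `W` gives a plane wave, which depends only on the Weyl orbit of
its frequency and so may be labelled by a dominant weight. -/
theorem exists_planeWaveSpan_eq_average [Fintype P.weylGroup] (b : P.Base) {p : smoothFunctions V}
    (hp : p ∈ trigPolys P) : ∃ t ∈ planeWaveSpan b, ∀ v,
      (t : V → ℂ) v = (Nat.card P.weylGroup : ℂ)⁻¹ * ∑ w : P.weylGroup, (p : V → ℂ) (w • v) := by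
  induction hp using Submodule.span_induction with
  | mem x hx =>
    obtain ⟨l, hl, rfl⟩ := hx
    obtain ⟨w, hw⟩ := exists_weyl_smul_mem_dominantWeights b hl
    refine ⟨_, Submodule.subset_span ⟨w • l, hw, rfl⟩, fun v ↦ ?_⟩
    dsimp only
    rw [← weyl_smul_smul, planeWaveSmooth_weyl_smul, planeWaveSmooth_apply]
    simp only [expWave_weyl_smul]
    congr 1
    exact (_root_.Equiv.sum_comp (Equiv.inv _)
      fun w : P.weylGroup ↦ (expWave (w • (2 * Real.pi) • l) : V → ℂ) v).symm
  | zero => exact ⟨0, zero_mem _, fun v ↦ by simp⟩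
  | add x y _ _ hx hy =>
    obtain ⟨p, hp, hp'⟩ := hx
    obtain ⟨r, hr, hr'⟩ := hy
    refine ⟨p + r, add_mem hp hr, fun v ↦ ?_⟩
    have h := congrArg₂ (· + ·) (hp' v) (hr' v)
    simp only [← mul_add, ← Finset.sum_add_distrib] at h
    exact h
  | smul c x _ hx =>
    obtain ⟨p, hp, hp'⟩ := hx
    refine ⟨c • p, Submodule.smul_mem _ c hp, fun v ↦ ?_⟩
    have h := congrArg (c * ·) (hp' v)
    simp only [mul_left_comm c, Finset.mul_sum] at h
    rw [Finset.mul_sum]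
    exact h

/-- Averaging over `W` fixes `G` and does not increase the uniform error of the approximating
polynomial. -/
theorem exists_planeWaveSpan_close (b : P.Base) {G : V → ℂ} (hG : Continuous G)
    (hW : ∀ (w : P.weylGroup) (v : V), G (w • v) = G v)
    (hL : ∀ q ∈ corootLattice P, ∀ v : V, G (q + v) = G v) {ε : ℝ} (hε : 0 < ε) :
    ∃ t ∈ planeWaveSpan b, ∀ v, ‖G v - (t : V → ℂ) v‖ ≤ ε := by
  have := Fintype.ofFinite P.weylGroup
  obtain ⟨p, hp, hpG⟩ := exists_trigPoly_close b hG hL hε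
  obtain ⟨t, ht, htp⟩ := exists_planeWaveSpan_eq_average b hp
  refine ⟨t, ht, fun v ↦ ?_⟩
  have h1 : G v - (t : V → ℂ) v = (Nat.card P.weylGroup : ℂ)⁻¹ *
      ∑ w : P.weylGroup, (G (w • v) - (p : V → ℂ) (w • v)) := by
    rw [Finset.sum_sub_distrib, mul_sub, ← htp]
    simp only [hW, Finset.sum_const, Finset.card_univ, nsmul_eq_mul, ← Nat.card_eq_fintype_card]
    rw [inv_mul_cancel_left₀ card_weylGroup_ne_zero]
  have h2 : (0 : ℝ) < Nat.card P.weylGroup := by exact_mod_cast Nat.card_pos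
  rw [h1, norm_mul, norm_inv, Complex.norm_natCast, inv_mul_le_iff₀ h2]
  refine (norm_sum_le _ _).trans ((Finset.sum_le_sum fun w _ ↦ hpG (w • v)).trans_eq ?_)
  simp [Nat.card_eq_fintype_card]

end Approximation

/-! ### Sums over affine Weyl orbits -/

section Periodization

variable {ι V : Type*} [Finite ι] [NormedAddCommGroup V] [InnerProductSpace ℝ V]
  [FiniteDimensional ℝ V] {P : RootPairing ι ℝ V V} [P.IsRootSystem] [IsEuclidean P]
  [P.IsCrystallographic]

variable (P) in
/-- The sum of a function over the orbits of the affine Weyl group. -/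
def orbitSum (g : V → ℂ) (v : V) : ℂ :=
  ∑ᶠ x : P.weylGroup × corootLattice P, g (x.2 + x.1 • v)

omit [Finite ι] [FiniteDimensional ℝ V] [P.IsRootSystem] [IsEuclidean P] [P.IsCrystallographic] in
theorem orbitSum_weyl_smul (g : V → ℂ) (w : P.weylGroup) (v : V) :
    orbitSum P g (w • v) = orbitSum P g v := by
  unfold orbitSum
  simp only [← mul_smul]
  exact finsum_comp_equiv ((Equiv.mulRight w).prodCongr (Equiv.refl _))
    (f := fun x : P.weylGroup × corootLattice P ↦ g (x.2 + x.1 • v))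

omit [Finite ι] [FiniteDimensional ℝ V] [P.IsRootSystem] [P.IsCrystallographic] in
theorem orbitSum_add (g : V → ℂ) {q : V} (hq : q ∈ corootLattice P) (v : V) :
    orbitSum P g (q + v) = orbitSum P g v := by
  unfold orbitSum
  let e : P.weylGroup × corootLattice P ≃ P.weylGroup × corootLattice P :=
    Equiv.prodShear (Equiv.refl _) fun w ↦
      Equiv.addRight ⟨w • q, weyl_smul_mem_corootLattice P w hq⟩
  refine Eq.trans (finsum_congr fun x ↦ ?_)
    (finsum_comp_equiv e (f := fun x : P.weylGroup × corootLattice P ↦ g (x.2 + x.1 • v)))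
  change _ = g ((x.2 : V) + x.1 • q + x.1 • v)
  rw [smul_add, add_assoc]

-- The sum is locally finite: on a ball, only lattice vectors up to a fixed norm can move a point
-- into the bounded support of `g`.
omit [FiniteDimensional ℝ V] in
theorem continuous_orbitSum {g : V → ℂ} (hg : Continuous g) (hc : HasCompactSupport g) :
    Continuous (orbitSum P g) := by
  refine continuous_finsum (fun x ↦ hg.comp
    (continuous_const.add (continuous_weyl_smul x.1))) fun v ↦ ?_
  obtain ⟨C, hC⟩ := hc.isCompact.isBounded.exists_norm_le
  refine ⟨Metric.ball 0 (‖v‖ + 1), Metric.isOpen_ball.mem_nhds (by simp), ?_⟩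
  have hfin : (Set.univ ×ˢ {q : corootLattice P | ‖(q : V)‖ ≤ C + (‖v‖ + 1)} :
      Set (P.weylGroup × corootLattice P)).Finite :=
    Set.finite_univ.prod (Set.Finite.of_finite_image
      ((finite_corootLattice_norm_le (P := P) (C + (‖v‖ + 1))).subset
        (by rintro _ ⟨q, hq, rfl⟩; exact ⟨q.2, hq⟩)) Subtype.val_injective.injOn)
  refine hfin.subset ?_
  rintro ⟨w, q⟩ ⟨u, hu, hub⟩
  refine ⟨trivial, ?_⟩
  have h1 := hC _ (subset_tsupport _ hu)
  have h2 : ‖u‖ < ‖v‖ + 1 := by simpa using hub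
  have h3 : (q : V) = (q + w • u) - w • u := by abel
  change ‖(q : V)‖ ≤ _
  rw [h3]
  refine (norm_sub_le _ _).trans (add_le_add h1 ?_)
  rw [norm_weyl_smul]
  exact h2.le

-- A point of the alcove returns to it only under the identity, so just one term survives.
omit [FiniteDimensional ℝ V] in
theorem orbitSum_eq_of_mem_alcove [P.IsReduced] (b : P.Base) {g : V → ℂ}
    (hg : tsupport g ⊆ alcove b) {v : V} (hv : v ∈ alcove b) : orbitSum P g v = g v := by
  unfold orbitSum
  rw [finsum_eq_single _ ((1 : P.weylGroup), (0 : corootLattice P))]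
  · simp
  · rintro ⟨w, q⟩ hne
    by_contra h
    obtain ⟨hq, hw⟩ := eq_of_add_smul_mem_alcove b hv q.2 (hg (subset_tsupport _ h))
    exact hne (Prod.ext hw (Subtype.ext hq))

end Periodization

/-! ### Completeness of the plane waves -/

section Completeness

variable {ι V : Type*} [Finite ι] [NormedAddCommGroup V] [InnerProductSpace ℝ V]
  [FiniteDimensional ℝ V] [MeasurableSpace V] [BorelSpace V] {P : RootPairing ι ℝ V V}
  [P.IsRootSystem] [IsEuclidean P] [P.IsCrystallographic] [P.IsReduced]

/-- By the fundamental lemma of the calculus of variations it suffices to test `f` against smooth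
`g` compactly supported in the alcove. The orbit sum of `g` is continuous, invariant and equal to
`g` on the alcove, hence a uniform limit there of combinations of plane waves, to which `f` is
orthogonal. -/
theorem eq_zero_of_forall_inner_planeWaveL2_eq_zero (b : P.Base) (f : L2 b)
    (h : ∀ μ ∈ dominantWeights b, ⟪planeWaveL2 b ((2 * Real.pi) • μ), f⟫_ℂ = 0) : f = 0 := by
  have hfin : IsFiniteMeasure ((volume : Measure V).restrict (alcove b)) :=
    isFiniteMeasure_restrict.mpr (isBounded_alcove b).measure_lt_top.ne
  have hf : IntegrableOn f (alcove b) := (Lp.memLp f).integrable (by norm_num)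
  have hmeas : MeasurableSet (alcove b) := (isOpen_alcove b).measurableSet
  have hspan : ∀ t ∈ planeWaveSpan b, ⟪restrict b t, f⟫_ℂ = 0 := by
    intro t ht
    induction ht using Submodule.span_induction with
    | mem x hx => obtain ⟨μ, hμ, rfl⟩ := hx; exact h μ hμ
    | zero => simp
    | add x y _ _ hx hy => rw [map_add, inner_add_left, hx, hy, add_zero]
    | smul c x _ hx => rw [map_smul, inner_smul_left, hx, mul_zero]
  have hinner : ∀ t ∈ planeWaveSpan b, ∫ v in alcove b, conj ((t : V → ℂ) v) * f v = 0 := by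
    intro t ht
    rw [← hspan t ht, L2.inner_def]
    refine integral_congr_ae ?_
    filter_upwards [(memLp_of_smooth b t).coeFn_toLp] with v hv
    change _ = ⟪(memLp_of_smooth b t).toLp _ v, f v⟫_ℂ
    rw [hv, RCLike.inner_apply, mul_comm]
  have key := (isOpen_alcove b).ae_eq_zero_of_integral_contDiff_smul_eq_zero (μ := volume)
    (f := f) hf.locallyIntegrableOn fun g hg hgc hgs ↦ ?_
  · refine Lp.ext ?_
    filter_upwards [(ae_restrict_iff' hmeas).mpr key, Lp.coeFn_zero ℂ 2
      ((volume : Measure V).restrict (alcove b))] with v h1 h2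
    rw [h1, h2]; rfl
  · have h0 : ∫ x, g x • f x = ∫ x in alcove b, (g x : ℂ) * f x := by
      rw [← setIntegral_eq_integral_of_forall_compl_eq_zero (s := alcove b)]
      · rfl
      · intro x hx
        rw [image_eq_zero_of_notMem_tsupport fun hx' ↦ hx (hgs hx'), zero_smul]
    rw [h0]
    let g' : V → ℂ := fun v ↦ (g v : ℂ)
    have hg'c : HasCompactSupport g' := hgc.comp_left Complex.ofReal_zero
    have hg's : tsupport g' ⊆ alcove b :=
      (tsupport_comp_subset Complex.ofReal_zero g).trans hgs
    have hg' : Continuous g' := Complex.continuous_ofReal.comp hg.continuous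
    have hG := continuous_orbitSum (P := P) hg' hg'c
    by_contra hne
    have hpos := norm_pos_iff.mpr hne
    set I := ∫ x in alcove b, (g x : ℂ) * f x with hI
    set N := ∫ x in alcove b, ‖f x‖ with hN
    have hN0 : 0 ≤ N := integral_nonneg fun _ ↦ norm_nonneg _
    -- With this `ε` the error is at most `‖I‖ * N / (2 * (N + 1))`, less than `‖I‖`; the `+ 1`
    -- covers `N = 0`.
    obtain ⟨t, ht, htG⟩ := exists_planeWaveSpan_close b hG (orbitSum_weyl_smul _)
      (fun q hq v ↦ orbitSum_add _ hq v) (ε := ‖I‖ / (2 * (N + 1))) (by positivity)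
    have ht' : Continuous (t : V → ℂ) := by
      have h : ContDiff ℝ ∞ (t : V → ℂ) := t.2
      exact h.continuous
    have hint : IntegrableOn (fun x ↦ conj ((t : V → ℂ) x) * f x) (alcove b) := by
      have := L2.integrable_inner (𝕜 := ℂ) (restrict b t) f
      refine this.congr ?_
      filter_upwards [(memLp_of_smooth b t).coeFn_toLp] with v hv
      change ⟪(memLp_of_smooth b t).toLp _ v, f v⟫_ℂ = _
      rw [hv, RCLike.inner_apply, mul_comm]
    have hint' : IntegrableOn (fun x ↦ (g x : ℂ) * f x) (alcove b) := by
      obtain ⟨C, hC⟩ := hg'.bounded_above_of_compact_support hg'c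
      exact hf.bdd_mul hg'.aestronglyMeasurable (.of_forall hC)
    have h1 : I = ∫ x in alcove b, ((g x : ℂ) - conj ((t : V → ℂ) x)) * f x := by
      simp_rw [sub_mul]
      rw [integral_sub hint' hint, hinner t ht, sub_zero]
    have h2 : ‖I‖ ≤ ∫ x in alcove b, ‖I‖ / (2 * (N + 1)) * ‖f x‖ := by
      rw [h1]
      refine norm_integral_le_of_norm_le (hf.norm.const_mul _) ?_
      refine (ae_restrict_iff' hmeas).mpr (.of_forall fun v hv ↦ ?_)
      rw [norm_mul]
      refine mul_le_mul_of_nonneg_right ?_ (norm_nonneg _)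
      have h3 := htG v
      rw [orbitSum_eq_of_mem_alcove b hg's hv] at h3
      rw [← h1]
      refine le_trans (le_of_eq ?_) h3
      -- As `g` is real, the conjugate of `t` approximates it equally well.
      rw [← RCLike.norm_conj (K := ℂ), map_sub, Complex.conj_conj, Complex.conj_ofReal]
    rw [integral_const_mul, ← hN, div_mul_eq_mul_div, le_div_iff₀ (by positivity)] at h2
    nlinarith

theorem span_planeWaveL2_topologicalClosure (b : P.Base) :
    (Submodule.span ℂ ((fun μ ↦ planeWaveL2 b ((2 * Real.pi) • μ)) ''
      dominantWeights b)).topologicalClosure = ⊤ := by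
  rw [Submodule.topologicalClosure_eq_top_iff, Submodule.eq_bot_iff]
  intro f hf
  exact eq_zero_of_forall_inner_planeWaveL2_eq_zero b f fun μ hμ ↦
    hf _ (Submodule.subset_span ⟨μ, hμ, rfl⟩)

end Completeness

end WeylAlcove

namespace UnboundedOperator

variable {H κ : Type*} [NormedAddCommGroup H] [InnerProductSpace ℂ H]

/-! ### Diagonal operators -/

section Diagonal

variable (B : HilbertBasis κ ℂ H)

theorem dense_span_basis : Dense (Submodule.span ℂ (Set.range B) : Set H) :=
  Submodule.dense_iff_topologicalClosure_eq_top.mpr B.dense_span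

theorem memℓp_mul {a : κ → ℂ} {M : ℝ} (ha : ∀ k, ‖a k‖ ≤ M) (x : lp (fun _ : κ ↦ ℂ) 2) :
    Memℓp (fun k ↦ a k * x k) 2 :=
  ((lp.memℓp x).const_smul (M : ℂ)).mono' fun k ↦ by
    rw [norm_mul, Pi.smul_apply, norm_smul, Complex.norm_real]
    exact mul_le_mul_of_nonneg_right ((ha k).trans (le_abs_self M)) (norm_nonneg _)

/-- The bounded operator that is diagonal in a Hilbert basis with given bounded entries. -/
def diagOp {a : κ → ℂ} {M : ℝ} (hM : 0 ≤ M) (ha : ∀ k, ‖a k‖ ≤ M) : H →L[ℂ] H :=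
  LinearMap.mkContinuous
    { toFun := fun x ↦ B.repr.symm ⟨fun k ↦ a k * B.repr x k, memℓp_mul ha _⟩
      map_add' := fun x y ↦ by
        rw [← map_add]
        congr 1
        ext k
        rw [map_add]
        exact mul_add _ _ _
      map_smul' := fun c x ↦ by
        rw [RingHom.id_apply, ← map_smul]
        congr 1
        ext k
        rw [map_smul]
        exact mul_left_comm _ _ _ } M fun x ↦ by
    have h : ‖(⟨fun k ↦ a k * B.repr x k, memℓp_mul ha _⟩ : lp (fun _ : κ ↦ ℂ) 2)‖ ≤
        ‖(M : ℂ) • B.repr x‖ := by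
      refine lp.norm_mono two_ne_zero fun k ↦ ?_
      change ‖a k * B.repr x k‖ ≤ ‖(M : ℂ) * B.repr x k‖
      rw [norm_mul, norm_mul, Complex.norm_real]
      exact mul_le_mul_of_nonneg_right ((ha k).trans (le_abs_self M)) (norm_nonneg _)
    rw [norm_smul, Complex.norm_real, Real.norm_of_nonneg hM, LinearIsometryEquiv.norm_map] at h
    exact (LinearIsometryEquiv.norm_map B.repr.symm _).trans_le h

variable {B} {a : κ → ℂ} {M : ℝ} (hM : 0 ≤ M) (ha : ∀ k, ‖a k‖ ≤ M)

theorem inner_diagOp (x : H) (k : κ) : ⟪B k, diagOp B hM ha x⟫_ℂ = a k * ⟪B k, x⟫_ℂ := by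
  rw [← B.repr_apply_apply, ← B.repr_apply_apply]
  change B.repr (B.repr.symm _) k = _
  rw [LinearIsometryEquiv.apply_symm_apply]

theorem norm_diagOp_le : ‖diagOp B hM ha‖ ≤ M :=
  LinearMap.mkContinuous_norm_le _ hM _

theorem ext_inner_basis {x y : H} (h : ∀ k, ⟪B k, x⟫_ℂ = ⟪B k, y⟫_ℂ) : x = y := by
  refine B.repr.injective (lp.ext (funext fun k ↦ ?_))
  rw [B.repr_apply_apply, B.repr_apply_apply, h]

theorem diagOp_basis (k : κ) : diagOp B hM ha (B k) = a k • B k := by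
  refine ext_inner_basis (B := B) fun j ↦ ?_
  rw [inner_diagOp, inner_smul_right]
  by_cases hjk : j = k
  · rw [hjk]
  · rw [B.orthonormal.2 hjk, mul_zero, mul_zero]

/-- A bounded operator that is diagonal in a Hilbert basis, with entries tending to zero, is
compact. -/
theorem isCompactOperator_of_diagonal [CompleteSpace H] (R : H →L[ℂ] H) (a : κ → ℂ)
    (hR : ∀ k, R (B k) = a k • B k) (ha : ∀ ε > 0, {k | ε ≤ ‖a k‖}.Finite) :
    IsCompactOperator R := by
  classical
  change R ∈ {S : H →L[ℂ] H | IsCompactOperator S}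
  refine isClosed_setOfPred_isCompactOperator.closure_subset
    (Metric.mem_closure_iff.mpr fun ε hε ↦ ?_)
  have hs := ha (ε / 2) (half_pos hε)
  -- The finite-rank truncation keeps the entries of size at least `ε / 2`; the remainder is
  -- diagonal with norm at most `ε / 2`.
  let S : H →L[ℂ] H := ∑ k ∈ hs.toFinset, (innerSL ℂ (B k)).smulRight (a k • B k)
  have hS : IsCompactOperator S := by
    have h1 : S ∈ compactOperator (RingHom.id ℂ) H H := by
      refine Submodule.sum_mem _ fun k _ ↦ ?_
      have h2 : IsCompactOperator (id : ℂ → ℂ) :=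
        isCompactOperator_id_iff_locallyCompactSpace.mpr inferInstance
      exact (h2.comp_clm (innerSL ℂ (B k))).clm_comp
        (ContinuousLinearMap.toSpanSingleton ℂ (a k • B k))
    exact h1
  have hSB : ∀ k, S (B k) = if ε / 2 ≤ ‖a k‖ then a k • B k else 0 := by
    intro k
    have h1 : ∀ j, (innerSL ℂ (B j)).smulRight (a j • B j) (B k) =
        if j = k then a j • B j else 0 := by
      intro j
      rw [ContinuousLinearMap.smulRight_apply, innerSL_apply_apply,
        orthonormal_iff_ite.mp B.orthonormal]
      split_ifs <;> simp
    simp only [S, sum_apply, h1, Finset.sum_ite_eq', Set.Finite.mem_toFinset,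
      Set.mem_ofPred_eq]
  let a' : κ → ℂ := fun k ↦ if ε / 2 ≤ ‖a k‖ then 0 else a k
  have ha' : ∀ k, ‖a' k‖ ≤ ε / 2 := by
    intro k
    by_cases hk : ε / 2 ≤ ‖a k‖
    · simp [a', hk, (half_pos hε).le]
    · simp only [a', hk, if_false]
      exact (not_le.mp hk).le
  have hdiff : R - S = diagOp B (half_pos hε).le ha' := by
    refine ContinuousLinearMap.ext_on (dense_span_basis B) ?_
    rintro _ ⟨k, rfl⟩
    rw [sub_apply, hR, hSB, diagOp_basis]
    by_cases hk : ε / 2 ≤ ‖a k‖ <;> simp [a', hk]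
  refine ⟨S, hS, ?_⟩
  rw [dist_eq_norm, hdiff]
  exact (norm_diagOp_le _ _).trans_lt (half_lt_self hε)

end Diagonal

/-! ### Symmetric operators with a Hilbert basis of eigenvectors -/

section Eigenbasis

variable [CompleteSpace H] {B : HilbertBasis κ ℂ H} {T : H →ₗ.[ℂ] H} {c : κ → ℝ}

omit [CompleteSpace H] in
theorem dense_domain_of_eigenbasis (hT : ∀ k, (B k, (c k : ℂ) • B k) ∈ T.graph) :
    Dense (T.domain : Set H) :=
  (dense_span_basis B).mono (Submodule.span_le.mpr (by
    rintro _ ⟨k, rfl⟩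
    exact LinearPMap.mem_domain_of_mem_graph (hT k)))

theorem isClosable_of_symmetric (hd : Dense (T.domain : Set H)) (hs : T.IsFormalAdjoint T) :
    T.IsClosable :=
  (LinearPMap.adjoint_isClosed hd).isClosable.leIsClosable (hs.le_adjoint hd)

/-- Pairing a point `(f, g)` of the adjoint graph with the eigenvectors shows that `g` has
coefficients `c k` times those of `f`. Partial sums of the two expansions then form points of the
graph of `T` converging to `(f, g)`. The converse holds as the adjoint is closed and extends `T`. -/
theorem adjoint_eq_closure (hs : T.IsFormalAdjoint T)
    (hT : ∀ k, (B k, (c k : ℂ) • B k) ∈ T.graph) : T.adjoint = T.closure := by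
  have hd := dense_domain_of_eigenbasis hT
  have hcl := isClosable_of_symmetric hd hs
  refine LinearPMap.eq_of_eq_graph (le_antisymm ?_ ?_)
  · rw [← hcl.graph_closure_eq_closure_graph]
    rintro ⟨f, g⟩ hfg
    have hrepr : ∀ k, B.repr g k = c k * B.repr f k := by
      intro k
      rw [LinearPMap.adjoint_graph_eq_graph_adjoint hd, Submodule.mem_adjoint_iff] at hfg
      have h := hfg _ _ (hT k)
      rw [inner_smul_left, Complex.conj_ofReal] at h
      rw [B.repr_apply_apply, B.repr_apply_apply]
      exact (sub_eq_zero.mp h).symm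
    have hlim := (B.hasSum_repr f).prodMk_nhds (B.hasSum_repr g)
    refine mem_closure_of_tendsto hlim (.of_forall fun s ↦ ?_)
    have h : ∑ k ∈ s, B.repr f k • (B k, (c k : ℂ) • B k) ∈ T.graph :=
      Submodule.sum_mem _ fun k _ ↦ Submodule.smul_mem _ _ (hT k)
    convert! h using 1
    simp only [hrepr, Prod.ext_iff, Prod.fst_sum, Prod.snd_sum, Prod.smul_mk, smul_smul,
      mul_comm (B.repr f _), and_self]
  · rw [← hcl.graph_closure_eq_closure_graph]
    exact Submodule.topologicalClosure_minimal _ (LinearPMap.le_graph_of_le (hs.le_adjoint hd))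
      (LinearPMap.adjoint_isClosed hd)

omit [CompleteSpace H] in
theorem inner_eq_of_mem_closure_graph (hcl : T.IsClosable) (hs : T.IsFormalAdjoint T) {x y : H × H}
    (hx : x ∈ T.closure.graph) (hy : y ∈ T.graph) : ⟪x.2, y.1⟫_ℂ = ⟪x.1, y.2⟫_ℂ := by
  rw [← hcl.graph_closure_eq_closure_graph] at hx
  have hclosed : IsClosed {x : H × H | ⟪x.2, y.1⟫_ℂ = ⟪x.1, y.2⟫_ℂ} :=
    isClosed_eq (by fun_prop) (by fun_prop)
  refine closure_minimal ?_ hclosed hx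
  intro x hx
  obtain ⟨u, hu⟩ := (LinearPMap.mem_graph_iff' T).mp hx
  obtain ⟨v, hv⟩ := (LinearPMap.mem_graph_iff' T).mp hy
  rw [← hu, ← hv]
  exact hs u v

/-- The adjoint of the closure lies in the adjoint of `T`, which is the closure; the other inclusion
is symmetry of the closure, inherited by continuity. -/
theorem isSelfAdjoint_closure_of_eigenbasis (hs : T.IsFormalAdjoint T)
    (hT : ∀ k, (B k, (c k : ℂ) • B k) ∈ T.graph) : IsSelfAdjoint T.closure := by
  have hd := dense_domain_of_eigenbasis hT
  have hcl := isClosable_of_symmetric hd hs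
  have hadj := adjoint_eq_closure hs hT
  have hd' : Dense (T.closure.domain : Set H) := hd.mono T.le_closure.1
  rw [LinearPMap.isSelfAdjoint_def]
  refine LinearPMap.eq_of_eq_graph (le_antisymm ?_ ?_)
  · rw [LinearPMap.adjoint_graph_eq_graph_adjoint hd']
    nth_rewrite 2 [← hadj]
    rw [LinearPMap.adjoint_graph_eq_graph_adjoint hd]
    intro x hx
    rw [Submodule.mem_adjoint_iff] at hx ⊢
    exact fun a d h ↦ hx a d (LinearPMap.le_graph_of_le T.le_closure h)
  · rw [LinearPMap.adjoint_graph_eq_graph_adjoint hd']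
    intro x hx
    rw [Submodule.mem_adjoint_iff]
    intro a d h
    rw [← hcl.graph_closure_eq_closure_graph] at h
    have hclosed : IsClosed {y : H × H | ⟪y.2, x.1⟫_ℂ - ⟪y.1, x.2⟫_ℂ = 0} :=
      isClosed_eq (by fun_prop) (by fun_prop)
    refine closure_minimal (fun y hy ↦ ?_) hclosed h
    have h1 := congrArg (starRingEnd ℂ) (inner_eq_of_mem_closure_graph hcl hs hx hy)
    rw [inner_conj_symm, inner_conj_symm] at h1
    exact sub_eq_zero.mpr h1.symm

/-- `S` equals its adjoint, which lies in the adjoint of `T`, that is, in the closure of `T`; and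
`S`, being closed, contains that closure. -/
theorem eq_closure_of_isSelfAdjoint_of_le (hs : T.IsFormalAdjoint T)
    (hT : ∀ k, (B k, (c k : ℂ) • B k) ∈ T.graph) {S : H →ₗ.[ℂ] H} (hS : IsSelfAdjoint S)
    (hTS : T ≤ S) : S = T.closure := by
  have hd := dense_domain_of_eigenbasis hT
  have hcl := isClosable_of_symmetric hd hs
  refine LinearPMap.eq_of_eq_graph (le_antisymm ?_ ?_)
  · rw [← adjoint_eq_closure hs hT, LinearPMap.adjoint_graph_eq_graph_adjoint hd]
    intro x hx
    rw [← LinearPMap.isSelfAdjoint_def.mp hS,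
      LinearPMap.adjoint_graph_eq_graph_adjoint hS.dense_domain, Submodule.mem_adjoint_iff] at hx
    rw [Submodule.mem_adjoint_iff]
    exact fun a d h ↦ hx a d (LinearPMap.le_graph_of_le hTS h)
  · rw [← hcl.graph_closure_eq_closure_graph]
    exact Submodule.topologicalClosure_minimal _ (LinearPMap.le_graph_of_le hTS) hS.isClosed

omit [CompleteSpace H] in
theorem isPositive_closure (hcl : T.IsClosable) (hp : IsPositive T) : IsPositive T.closure := by
  intro f
  have hmem := T.closure.mem_graph f
  rw [← hcl.graph_closure_eq_closure_graph] at hmem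
  have hclosed : IsClosed {x : H × H | 0 ≤ (⟪x.1, x.2⟫_ℂ).re} :=
    isClosed_le (by fun_prop) (by fun_prop)
  refine closure_minimal (fun x hx ↦ ?_) hclosed hmem
  obtain ⟨u, hu⟩ := (LinearPMap.mem_graph_iff' T).mp hx
  rw [← hu]
  exact hp u

omit [CompleteSpace H] in
theorem nonneg_of_isPositive (hp : IsPositive T)
    (hT : ∀ k, (B k, (c k : ℂ) • B k) ∈ T.graph) (k : κ) : 0 ≤ c k := by
  obtain ⟨u, hu⟩ := (LinearPMap.mem_graph_iff' T).mp (hT k)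
  have h := hp u
  rw [(Prod.mk.inj hu).1, (Prod.mk.inj hu).2, inner_smul_right, inner_self_eq_norm_sq_to_K,
    B.orthonormal.1 k] at h
  simpa using h

/-- Positivity puts -1 in the resolvent set, with entries `1 / (c k + 1)`. Every resolvent is
diagonal with entries `1 / (c k - z)`, and only finitely many of these exceed a given size. -/
theorem hasCompactResolvent_closure (hs : T.IsFormalAdjoint T) (hp : IsPositive T)
    (hT : ∀ k, (B k, (c k : ℂ) • B k) ∈ T.graph) (hfin : ∀ C, {k | c k ≤ C}.Finite) :
    HasCompactResolvent T.closure := by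
  have hd := dense_domain_of_eigenbasis hT
  have hcl := isClosable_of_symmetric hd hs
  have hc := nonneg_of_isPositive hp hT
  have hle := LinearPMap.le_graph_of_le T.le_closure
  constructor
  · have hne : ∀ k, (c k + 1 : ℂ) ≠ 0 := by
      intro k h
      have h1 := congrArg Complex.re h
      simp at h1
      linarith [hc k]
    have ha : ∀ k, ‖((c k : ℂ) + 1)⁻¹‖ ≤ 1 := by
      intro k
      rw [norm_inv]
      refine inv_le_one_of_one_le₀ ?_
      rw [← Complex.ofReal_one, ← Complex.ofReal_add, Complex.norm_real]
      exact (by linarith [hc k] : (1 : ℝ) ≤ c k + 1).trans (le_abs_self _)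
    let R := diagOp B zero_le_one ha
    refine ⟨-1, R, fun g ↦ ?_, fun f ↦ ?_⟩
    · let p : H →L[ℂ] H × H := R.prod (ContinuousLinearMap.id ℂ H - R)
      have hclosed : IsClosed (T.closure.graph : Set (H × H)) := hcl.closure_isClosed
      have hmem : ∀ g, p g ∈ T.closure.graph := by
        have h1 : Submodule.span ℂ (Set.range B) ≤ T.closure.graph.comap (p : H →ₗ[ℂ] H × H) := by
          refine Submodule.span_le.mpr ?_
          rintro _ ⟨k, rfl⟩
          have h2 : p (B k) = ((c k : ℂ) + 1)⁻¹ • (B k, (c k : ℂ) • B k) := by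
            have h3 : B k - ((c k : ℂ) + 1)⁻¹ • B k = (((c k : ℂ) + 1)⁻¹ * c k) • B k := by
              have : ((c k : ℂ) + 1)⁻¹ * c k = 1 - ((c k : ℂ) + 1)⁻¹ := by
                have := hne k
                field_simp
                ring
              rw [this, sub_smul, one_smul]
            change (R (B k), B k - R (B k)) = _
            rw [diagOp_basis, h3, Prod.smul_mk, smul_smul]
          change p (B k) ∈ T.closure.graph
          rw [h2]
          exact Submodule.smul_mem _ _ (hle (hT k))
        intro g
        exact closure_minimal h1 (hclosed.preimage p.continuous) (dense_span_basis B g)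
      have h := hmem g
      have hdom : R g ∈ T.closure.domain := LinearPMap.mem_domain_of_mem_graph h
      refine ⟨hdom, ?_⟩
      rw [← (LinearPMap.image_iff hdom).mpr h]
      change g - R g - (-1 : ℂ) • R g = g
      module
    · refine ext_inner_basis (B := B) fun k ↦ ?_
      have h := inner_eq_of_mem_closure_graph hcl hs (T.closure.mem_graph f) (hT k)
      have h1 := congrArg (starRingEnd ℂ) h
      simp only [inner_smul_right, map_mul, Complex.conj_ofReal, inner_conj_symm] at h1
      rw [inner_diagOp, inner_sub_right, inner_smul_right, h1, neg_one_mul, sub_neg_eq_add,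
        ← add_one_mul, inv_mul_cancel_left₀ (hne k)]
  · rintro z R ⟨-, hR⟩
    have hRB : ∀ k, ((c k : ℂ) - z) • R (B k) = B k := by
      intro k
      have hmem := hle (hT k)
      have hdom := LinearPMap.mem_domain_of_mem_graph hmem
      have h := hR ⟨B k, hdom⟩
      rw [← (LinearPMap.image_iff hdom).mpr hmem, ← sub_smul, map_smul] at h
      exact h
    have hne : ∀ k, (c k : ℂ) - z ≠ 0 := by
      intro k h
      have h1 := hRB k
      rw [h, zero_smul] at h1
      exact B.orthonormal.ne_zero k h1.symm
    refine isCompactOperator_of_diagonal (B := B) R (fun k ↦ ((c k : ℂ) - z)⁻¹) (fun k ↦ ?_) ?_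
    · nth_rewrite 2 [← hRB k]
      rw [inv_smul_smul₀ (hne k)]
    · intro ε hε
      refine (hfin (ε⁻¹ + ‖z‖)).subset fun k hk ↦ ?_
      have h1 : ε ≤ ‖((c k : ℂ) - z)⁻¹‖ := hk
      rw [norm_inv] at h1
      have h2 : ‖(c k : ℂ) - z‖ ≤ ε⁻¹ := by
        rw [← inv_inv ‖(c k : ℂ) - z‖]
        exact inv_anti₀ hε h1
      have h3 : c k ≤ ‖(c k : ℂ)‖ := by
        rw [Complex.norm_real]
        exact le_abs_self _
      have h4 : ‖(c k : ℂ)‖ ≤ ‖(c k : ℂ) - z‖ + ‖z‖ := by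
        simpa using norm_add_le ((c k : ℂ) - z) z
      change c k ≤ _
      linarith

end Eigenbasis

end UnboundedOperator

/-! ### The plane-wave eigenbasis of `-Δ` -/

namespace WeylAlcove

section Spectrum

variable {ι V : Type*} [Finite ι] [NormedAddCommGroup V] [InnerProductSpace ℝ V]
  [FiniteDimensional ℝ V] [MeasurableSpace V] [BorelSpace V] {P : RootPairing ι ℝ V V}
  [P.IsRootSystem]

theorem exists_eq_of_mem_negLaplacian_domain (b : P.Base) (f : (negLaplacian b).domain) :
    ∃ F ∈ invariantSmoothFunctions P, restrict b F = f ∧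
      -restrict b (laplacian V F) = negLaplacian b f := by
  have h := (negLaplacian b).mem_graph f
  rw [negLaplacian_graph] at h
  obtain ⟨F, hF, hFf⟩ := h
  exact ⟨F, hF, Prod.mk.inj hFf⟩

variable [IsEuclidean P]

theorem planeWaveL2_mem_negLaplacian_graph (b : P.Base) {μ : V} (hμ : μ ∈ dominantWeights b) :
    (planeWaveL2 b ((2 * Real.pi) • μ),
      ((‖(2 * Real.pi) • μ‖ ^ 2 : ℝ) : ℂ) • planeWaveL2 b ((2 * Real.pi) • μ)) ∈
        (negLaplacian b).graph := by
  rw [negLaplacian_graph]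
  refine ⟨planeWaveSmooth P ((2 * Real.pi) • μ),
    planeWaveSmooth_mem (isWeight_of_mem_dominantWeights hμ), Prod.ext rfl ?_⟩
  change -restrict b (laplacian V (planeWaveSmooth P _)) = _
  rw [laplacian_planeWaveSmooth, map_smul, neg_smul, neg_neg]
  rfl

variable [P.IsCrystallographic] [P.IsReduced]

theorem negLaplacian_isFormalAdjoint (b : P.Base) :
    (negLaplacian b).IsFormalAdjoint (negLaplacian b) := by
  intro f g
  obtain ⟨F, hF, hf, hf'⟩ := exists_eq_of_mem_negLaplacian_domain b f
  obtain ⟨G, hG, hg, hg'⟩ := exists_eq_of_mem_negLaplacian_domain b g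
  rw [← hf, ← hg, ← hf', ← hg']
  exact inner_laplacian_left_eq b hF hG

theorem negLaplacian_isPositive (b : P.Base) :
    UnboundedOperator.IsPositive (negLaplacian b) := by
  intro f
  obtain ⟨F, hF, hf, hf'⟩ := exists_eq_of_mem_negLaplacian_domain b f
  rw [← hf, ← hf']
  exact re_inner_laplacian_nonneg b hF

theorem orthonormal_normalizedPlaneWaves (b : P.Base) :
    Orthonormal ℂ fun μ : dominantWeights b ↦
      (‖planeWaveL2 b ((2 * Real.pi) • (μ : V))‖⁻¹ : ℂ) •
        planeWaveL2 b ((2 * Real.pi) • (μ : V)) := by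
  refine ⟨fun μ ↦ norm_smul_inv_norm (planeWaveL2_ne_zero b _), fun μ ν hne ↦ ?_⟩
  beta_reduce
  rw [inner_smul_left, inner_smul_right,
    inner_planeWaveL2_eq_zero b μ.2 ν.2 (Subtype.coe_injective.ne hne), mul_zero, mul_zero]

/-- The Hilbert basis of `L²(A)` formed by the normalized plane waves. -/
def planeWaveBasis (b : P.Base) : HilbertBasis (dominantWeights b) ℂ (L2 b) :=
  HilbertBasis.mkOfOrthogonalEqBot (orthonormal_normalizedPlaneWaves b)
    ((Submodule.eq_bot_iff _).mpr fun f hf ↦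
      eq_zero_of_forall_inner_planeWaveL2_eq_zero b f fun μ hμ ↦ by
        have h := (Submodule.mem_orthogonal _ _).mp hf _ (Submodule.subset_span ⟨⟨μ, hμ⟩, rfl⟩)
        rw [inner_smul_left] at h
        refine (mul_eq_zero.mp h).resolve_left ?_
        simpa using planeWaveL2_ne_zero b _)

theorem planeWaveBasis_mem_negLaplacian_graph (b : P.Base) (μ : dominantWeights b) :
    (planeWaveBasis b μ,
      ((‖(2 * Real.pi) • (μ : V)‖ ^ 2 : ℝ) : ℂ) • planeWaveBasis b μ) ∈
        (negLaplacian b).graph := by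
  rw [planeWaveBasis, HilbertBasis.coe_mkOfOrthogonalEqBot, smul_comm]
  exact Submodule.smul_mem _ _ (planeWaveL2_mem_negLaplacian_graph b μ.2)

omit [IsEuclidean P] [P.IsCrystallographic] [P.IsReduced] [FiniteDimensional ℝ V]
  [MeasurableSpace V] [BorelSpace V] in
theorem finite_eigenvalues_le (b : P.Base) (C : ℝ) :
    {μ : dominantWeights b | ‖(2 * Real.pi) • (μ : V)‖ ^ 2 ≤ C}.Finite := by
  -- The bound `C + 1` avoids a square root: for `x = 2 * π * ‖μ‖` one has `‖μ‖ ≤ x` and `2 * x ≤ x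
  -- ^ 2 + 1 ≤ C + 1`.
  refine ((finite_dominantWeights_norm_le b (C + 1)).preimage
    Subtype.val_injective.injOn).subset fun μ hμ ↦ ⟨μ.2, ?_⟩
  have h : ‖(2 * Real.pi) • (μ : V)‖ ^ 2 ≤ C := hμ
  rw [norm_smul, Real.norm_of_nonneg Real.two_pi_pos.le] at h
  have h1 : ‖(μ : V)‖ ≤ 2 * Real.pi * ‖(μ : V)‖ :=
    le_mul_of_one_le_left (norm_nonneg _) (by linarith [Real.pi_gt_three])
  nlinarith [sq_nonneg (2 * Real.pi * ‖(μ : V)‖ - 1)]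

end Spectrum

end WeylAlcove

end

/-! ### Assembly: the self-adjoint extension is the closure -/

theorem proposition4p1 {ι V : Type*} [Finite ι] [NormedAddCommGroup V] [InnerProductSpace ℝ V]
    [FiniteDimensional ℝ V] [MeasurableSpace V] [BorelSpace V]
    (P : RootPairing ι ℝ V V) [WeylAlcove.IsEuclidean P] [P.IsRootSystem] [P.IsCrystallographic]
    [P.IsReduced] [P.IsIrreducible] (b : P.Base) :
    UnboundedOperator.IsEssentiallySelfAdjoint (WeylAlcove.negLaplacian b) ∧
    UnboundedOperator.IsPositive (WeylAlcove.negLaplacian b) ∧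
    ∃ H₀ : WeylAlcove.L2 b →ₗ.[ℂ] WeylAlcove.L2 b,
      -- `H₀` is the unique self-adjoint extension of `-Δ`; it is positive, with operator core `D₀`
      (IsSelfAdjoint H₀ ∧ UnboundedOperator.IsPositive H₀ ∧ WeylAlcove.negLaplacian b ≤ H₀) ∧
      (∀ H' : WeylAlcove.L2 b →ₗ.[ℂ] WeylAlcove.L2 b,
        IsSelfAdjoint H' → WeylAlcove.negLaplacian b ≤ H' → H' = H₀) ∧
      H₀.HasCore (WeylAlcove.D₀ b) ∧
      -- the plane waves are eigenfunctions in `D₀`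
      (∀ μ ∈ WeylAlcove.dominantWeights b,
        WeylAlcove.planeWaveL2 b ((2 * Real.pi) • μ) ∈ WeylAlcove.D₀ b ∧
        WeylAlcove.planeWaveL2 b ((2 * Real.pi) • μ) ≠ 0 ∧
        ∃ h : WeylAlcove.planeWaveL2 b ((2 * Real.pi) • μ) ∈ H₀.domain,
          H₀ ⟨WeylAlcove.planeWaveL2 b ((2 * Real.pi) • μ), h⟩ =
            ((‖(2 * Real.pi) • μ‖ ^ 2 : ℝ) : ℂ) •
              WeylAlcove.planeWaveL2 b ((2 * Real.pi) • μ)) ∧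
      -- they are pairwise orthogonal and complete
      (∀ μ ∈ WeylAlcove.dominantWeights b, ∀ ν ∈ WeylAlcove.dominantWeights b, μ ≠ ν →
        ⟪WeylAlcove.planeWaveL2 b ((2 * Real.pi) • μ),
          WeylAlcove.planeWaveL2 b ((2 * Real.pi) • ν)⟫_ℂ = 0) ∧
      (Submodule.span ℂ ((fun μ ↦ WeylAlcove.planeWaveL2 b ((2 * Real.pi) • μ)) ''
        WeylAlcove.dominantWeights b)).topologicalClosure = ⊤ ∧
      UnboundedOperator.HasCompactResolvent H₀ := by
  have hs := WeylAlcove.negLaplacian_isFormalAdjoint b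
  have hp := WeylAlcove.negLaplacian_isPositive b
  have hT := WeylAlcove.planeWaveBasis_mem_negLaplacian_graph b
  have hd := UnboundedOperator.dense_domain_of_eigenbasis hT
  have hcl := UnboundedOperator.isClosable_of_symmetric hd hs
  have hle := (WeylAlcove.negLaplacian b).le_closure
  have hsa := UnboundedOperator.isSelfAdjoint_closure_of_eigenbasis hs hT
  refine ⟨⟨hd, hs, hsa⟩, hp, (WeylAlcove.negLaplacian b).closure,
    ⟨hsa, UnboundedOperator.isPositive_closure hcl hp, hle⟩,
    fun H' hH' h ↦ UnboundedOperator.eq_closure_of_isSelfAdjoint_of_le hs hT hH' h, ?_,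
    fun μ hμ ↦ ⟨⟨_, WeylAlcove.planeWaveSmooth_mem
      (WeylAlcove.isWeight_of_mem_dominantWeights hμ), rfl⟩,
      WeylAlcove.planeWaveL2_ne_zero b _, ?_⟩,
    fun μ hμ ν hν hne ↦ WeylAlcove.inner_planeWaveL2_eq_zero b hμ hν hne,
    WeylAlcove.span_planeWaveL2_topologicalClosure b,
    UnboundedOperator.hasCompactResolvent_closure hs hp hT (WeylAlcove.finite_eigenvalues_le b)⟩
  · rw [← WeylAlcove.negLaplacian_domain]
    exact LinearPMap.closureHasCore _
  · have h := LinearPMap.le_graph_of_le hle (WeylAlcove.planeWaveL2_mem_negLaplacian_graph b hμ)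
    have hdom := LinearPMap.mem_domain_of_mem_graph h
    exact ⟨hdom, ((LinearPMap.image_iff hdom).mpr h).symm⟩
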